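/- Let $(\Omega,\mathcal F,\mathbb P)$ be a complete probability space, $X=(X_t)_{t\ge 0}$ a real-valued Lévy process on it with $X_0=0$ a.s. (independent and stationary increments, a.s. right-continuous paths with left limits), and $\mathbb F$ the filtration generated by $X$, completed by the $\mathbb P$-null sets. For $x\in\mathbb R$ let $\mathbb E^x$ be the expectation for the process started at $x$, that is, with $X$ replaced by $x+X$. Let $r>0$, let $$\theta:=\inf\{t\ge 0: X_t\le 0\}\quad(\inf\emptyset=\infty)$$ be the default time (under $\mathbb P^x$: of the process $x+X$), and let $\mathcal S$ be the set of $\mathbb F$-stopping times $\tau$ with $\tau\le\theta$ a.s.; $e^{-r\infty}:=0$. For real parameters define the perpetual CDS price $$C(x;p,\alpha):=\mathbb E^x\Big[-\int_0^\theta e^{-rt}p\,dt+\alpha e^{-r\theta}\Big],$$ the perpetual American default swaption price $$u(x;\kappa,a,K):=\sup_{\tau\in\mathcal S}\mathbb E^x\Big[e^{-r\tau}\big(-C(X_\tau;\kappa,a)-K\big)^+1_{\{\tau<\theta\}}\Big],$$ and the value to the protection seller of the perpetual American putable step-up/down default swap with initial premium $p$ and default payment $\alpha$, new premium $\hat p$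 and default payment $\hat\alpha$ after exercise, and switching fee $\gamma$, $$U(x;p,\hat p,\alpha,\hat\alpha,\gamma):=\sup_{\tau\in\mathcal S}\mathbb E^x\Big[\int_0^\tau e^{-rt}p\,dt+1_{\{\tau<\infty\}}\Big(\int_\tau^\theta e^{-rt}\hat p\,dt-e^{-r\tau}\gamma 1_{\{\tau<\theta\}}-e^{-r\theta}\big(\hat\alpha 1_{\{\tau<\theta\}}+\alpha 1_{\{\tau=\theta\}}\big)\Big)\Big].$$ Put $\tilde p:=p-\hat p$ and $\tilde\alpha:=\alpha-\hat\alpha$. Then for all $x\in\mathbb R$ and all real $p,\hat p,\alpha,\hat\alpha,\gamma$ (in particular for the nonnegative parameters of a step-up or step-down contract), in $C(x;p,\alpha)$, $u(x;-\tilde p,-\tilde\alpha,\gamma)$ and $U(x;p,\hat p,\alpha,\hat\alpha,\gamma)$ all the random variables under the expectations are integrable, both suprema are finite, and $$U(x;p,\hat p,\alpha,\hat\alpha,\gamma)=-C(x;p,\alpha)+u(x;-\tilde p,-\tilde\alpha,\gamma).$$ That is, the putable default swap equals a short perpetual vanilla CDS plus a long perpetual American receiver/payer default swaption. -/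

import Mathlib

open MeasureTheory ProbabilityTheory Filter Topology
open scoped NNReal

namespace DefaultSwap

/-- A real-valued Lévy process started at `0`: `X 0 = 0` a.s., independent and stationary
increments, and almost surely right-continuous paths with left limits. -/
structure IsLevyProcess {Ω : Type*} [MeasurableSpace Ω] (X : ℝ≥0 → Ω → ℝ) (P : Measure Ω) :
    Prop where
  measurable : ∀ t, Measurable (X t)
  zero : ∀ᵐ ω ∂P, X 0 ω = 0
  indep : HasIndepIncrements X P
  stationary : ∀ s t : ℝ≥0, IdentDistrib (fun ω => X (s + t) ω - X s ω) (X t) P P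
  cadlag : ∀ᵐ ω ∂P, ∀ t : ℝ≥0,
    ContinuousWithinAt (fun s => X s ω) (Set.Ici t) t ∧
      ∃ l : ℝ, Tendsto (fun s => X s ω) (𝓝[<] t) (𝓝 l)

/-- The filtration generated by `X`, completed: `𝓕 t` consists of the sets that differ by a
`P`-null set from an element of `σ(X s : s ≤ t)`. -/
def completedFiltration {Ω : Type*} [mΩ : MeasurableSpace Ω] (P : Measure Ω) [P.IsComplete]
    (X : ℝ≥0 → Ω → ℝ) (hX : ∀ t, Measurable (X t)) : Filtration ℝ≥0 mΩ where
  seq t := eventuallyMeasurableSpace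
    (Filtration.natural X (fun s => (hX s).stronglyMeasurable) t) (ae P)
  mono' := by
    rintro s t hst A ⟨B, hB, hAB⟩
    exact ⟨B, (Filtration.natural X _).mono hst B hB, hAB⟩
  le' := by
    rintro t A ⟨B, hB, hAB⟩
    have hB' : MeasurableSet B := (Filtration.natural X _).le t B hB
    exact (hB'.nullMeasurableSet.congr hAB.symm).measurable_of_complete

/-- The process `x + X`. Its law under `P` is the law `ℙ^x` of the Lévy process started
at `x`; `𝔼^x` of a functional of the process is the `P`-expectation of that functional
of `x + X`. -/
def shifted {Ω : Type*} (X : ℝ≥0 → Ω → ℝ) (x : ℝ) : ℝ≥0 → Ω → ℝ := fun t ω => x + X t ω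

/-- The default time `θ = inf {t ≥ 0 : x + X t ≤ 0}`, with `inf ∅ = ∞`. -/
noncomputable def defaultTime {Ω : Type*} (X : ℝ≥0 → Ω → ℝ) (x : ℝ) : Ω → WithTop ℝ≥0 :=
  hittingAfter (shifted X x) (Set.Iic 0) 0

/-- The set `𝓢` of stopping times `τ` with `τ ≤ θ` almost surely (for starting point `x`). -/
def admissible {Ω : Type*} [MeasurableSpace Ω] (P : Measure Ω) [P.IsComplete]
    (X : ℝ≥0 → Ω → ℝ) (hX : ∀ t, Measurable (X t)) (x : ℝ) : Set (Ω → WithTop ℝ≥0) :=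
  {τ | IsStoppingTime (completedFiltration P X hX) τ ∧ ∀ᵐ ω ∂P, τ ω ≤ defaultTime X x ω}

/-- The discount factor `e^{-r t}`, with `e^{-r ∞} = 0`. -/
noncomputable def discount (r : ℝ) : WithTop ℝ≥0 → ℝ
  | ⊤ => 0
  | (t : ℝ≥0) => Real.exp (-(r * t))

/-- The discounted premium `∫_a^b e^{-r t} c dt` for `0 ≤ a ≤ b ≤ ∞`. -/
noncomputable def premiumLeg (r c : ℝ) (a b : WithTop ℝ≥0) : ℝ :=
  ∫ t in {t : ℝ | 0 ≤ t ∧ a < (t.toNNReal : WithTop ℝ≥0) ∧ (t.toNNReal : WithTop ℝ≥0) ≤ b},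
    Real.exp (-(r * t)) * c

/-- Discounted cash flow of the buyer of a perpetual CDS:
`-∫_0^θ e^{-rt} p dt + α e^{-rθ}`. -/
noncomputable def cdsCashFlow {Ω : Type*} (X : ℝ≥0 → Ω → ℝ) (r x p α : ℝ) (ω : Ω) : ℝ :=
  -premiumLeg r p 0 (defaultTime X x ω) + α * discount r (defaultTime X x ω)

/-- The buyer's price `C(x; p, α)` of the perpetual CDS. -/
noncomputable def C {Ω : Type*} [MeasurableSpace Ω] (P : Measure Ω) (X : ℝ≥0 → Ω → ℝ)
    (r x p α : ℝ) : ℝ :=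
  ∫ ω, cdsCashFlow X r x p α ω ∂P

/-- Discounted swaption payoff `e^{-rτ} (-C(X_τ; κ, a) - K)⁺ 1_{τ < θ}` when exercising
at `τ`. -/
noncomputable def swaptionPayoff {Ω : Type*} [MeasurableSpace Ω] (P : Measure Ω)
    (X : ℝ≥0 → Ω → ℝ) (r x κ a K : ℝ) (τ : Ω → WithTop ℝ≥0) (ω : Ω) : ℝ :=
  if τ ω < defaultTime X x ω then
    discount r (τ ω) * max (-C P X r (stoppedValue (shifted X x) τ ω) κ a - K) 0
  else 0

/-- The expected discounted swaption payoffs over all `τ ∈ 𝓢`. -/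
def swaptionValues {Ω : Type*} [MeasurableSpace Ω] (P : Measure Ω) [P.IsComplete]
    (X : ℝ≥0 → Ω → ℝ) (hX : ∀ t, Measurable (X t)) (r x κ a K : ℝ) : Set ℝ :=
  (fun τ => ∫ ω, swaptionPayoff P X r x κ a K τ ω ∂P) '' admissible P X hX x

/-- The price `u(x; κ, a, K)` of the perpetual American default swaption. -/
noncomputable def u {Ω : Type*} [MeasurableSpace Ω] (P : Measure Ω) [P.IsComplete]
    (X : ℝ≥0 → Ω → ℝ) (hX : ∀ t, Measurable (X t)) (r x κ a K : ℝ) : ℝ :=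
  sSup (swaptionValues P X hX r x κ a K)

/-- Discounted cash flow of the seller of the putable default swap who switches from
`(p, α)` to `(ph, αh)` at `τ` for the fee `γ`:
`∫_0^τ e^{-rt} p dt + 1_{τ<∞} (∫_τ^θ e^{-rt} ph dt - e^{-rτ} γ 1_{τ<θ}
  - e^{-rθ} (αh 1_{τ<θ} + α 1_{τ=θ}))`. -/
noncomputable def putableCashFlow {Ω : Type*} (X : ℝ≥0 → Ω → ℝ) (r x p ph α αh γ : ℝ)
    (τ : Ω → WithTop ℝ≥0) (ω : Ω) : ℝ :=
  premiumLeg r p 0 (τ ω) +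
    if τ ω < ⊤ then
      premiumLeg r ph (τ ω) (defaultTime X x ω)
        - discount r (τ ω) * γ * (if τ ω < defaultTime X x ω then 1 else 0)
        - discount r (defaultTime X x ω) *
            (αh * (if τ ω < defaultTime X x ω then 1 else 0)
              + α * (if τ ω = defaultTime X x ω then 1 else 0))
    else 0

/-- The seller's expected discounted cash flows over all `τ ∈ 𝓢`. -/
def putableValues {Ω : Type*} [MeasurableSpace Ω] (P : Measure Ω) [P.IsComplete]
    (X : ℝ≥0 → Ω → ℝ) (hX : ∀ t, Measurable (X t)) (r x p ph α αh γ : ℝ) : Set ℝ :=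
  (fun τ => ∫ ω, putableCashFlow X r x p ph α αh γ τ ω ∂P) '' admissible P X hX x

/-- The seller's value `U(x; p, ph, α, αh, γ)` of the perpetual American putable
step-up/down default swap. -/
noncomputable def U {Ω : Type*} [MeasurableSpace Ω] (P : Measure Ω) [P.IsComplete]
    (X : ℝ≥0 → Ω → ℝ) (hX : ∀ t, Measurable (X t)) (r x p ph α αh γ : ℝ) : ℝ :=
  sSup (putableValues P X hX r x p ph α αh γ)

end DefaultSwap

namespace DefaultSwap

/-! Pathwise, on `τ ≤ θ`, the putable swap is a short CDS plus, on `τ < θ`, an amount affine in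
`e^{-rτ}` and `e^{-rθ}`, because premium legs integrate to differences of discount factors
(`putableCashFlow_eq`). The strong Markov property at `τ` replaces `e^{-rθ}` by `e^{-rτ}` times the
expected default discount from `X_τ`, and the affine amount becomes `e^{-rτ} g(X_τ)` with `g = -C(·;
-p̃, -α̃) - γ` (`integrable_putableCashFlow`). It remains to compare the suprema of the expectations
of `e^{-rτ} g(X_τ) 1_{τ<θ}` with `g` and with `g⁺`. One bound is `g ≤ g⁺`; for the other, stop at
`τ` where `g ≥ 0` and wait for default elsewhere (`exerciseIfNonneg`).

The real work is measurability. The filtration is completed but not assumed right-continuous, and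
`θ` is the entry time of a closed set by a process with jumps. That `θ` is a stopping time rests on
quasi-left-continuity at `0` (`ae_exists_le_zero`): were the path to approach `0` from above without
entering, it would jump up by a fixed amount within an arbitrarily short time after its passages
below small levels. By the strong Markov property at these passage times, this is no likelier than
such an excursion right after time `0`, whose probability vanishes by right-continuity. The same
fact makes `e^{-rθ}` a measurable functional of the path (`discount_defaultTime_eq`), so that Fubini
applies. -/

/-- Every finite set of times lies in the range of a monotone sequence. -/
lemma exists_monotone_nat_enum (S : Finset ℝ≥0) :
    ∃ t : ℕ → ℝ≥0, Monotone t ∧ ∀ u ∈ S, ∃ j, t j = u := by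
  rcases S.eq_empty_or_nonempty with rfl | hS
  · exact ⟨fun _ => 0, monotone_const, by simp⟩
  have hc : 0 < S.card := hS.card_pos
  let e := S.orderEmbOfFin rfl
  refine ⟨fun i => e ⟨min i (S.card - 1), by omega⟩, fun a b hab => ?_, fun u hu => ?_⟩
  · exact e.monotone (by simp only [Fin.mk_le_mk]; omega)
  · have : u ∈ Set.range e := by simpa [e] using hu
    obtain ⟨i, rfl⟩ := this
    exact ⟨i, congrArg e (Fin.ext (min_eq_left (Nat.le_sub_one_of_lt i.2)))⟩

/-! ### Independence and law of future increments; simple Markov property -/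

section Markov

variable {Ω : Type*} [mΩ : MeasurableSpace Ω] {P : Measure Ω} {X : ℝ≥0 → Ω → ℝ}

/-- The process after time `s`, started afresh at `0`. -/
def increments (X : ℝ≥0 → Ω → ℝ) (s : ℝ≥0) (ω : Ω) (t : ℝ≥0) : ℝ := X (s + t) ω - X s ω

lemma IsLevyProcess.measurable_increments (hX : IsLevyProcess X P) (s : ℝ≥0) :
    Measurable (increments X s) :=
  measurable_pi_lambda _ fun _ => (hX.measurable _).sub (hX.measurable _)

lemma IsLevyProcess.measurable_path (hX : IsLevyProcess X P) :
    Measurable (fun ω t => X t ω) :=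
  measurable_pi_lambda _ fun _ => hX.measurable _

/-- The future increments of a Lévy process are independent of its past. -/
lemma IsLevyProcess.indepFun_past [IsProbabilityMeasure P] (hX : IsLevyProcess X P) (s : ℝ≥0) :
    IndepFun (fun ω (v : Set.Iic s) => X v ω) (increments X s) P := by
  -- Increments only see `X v - X 0`, which is `X v` almost surely.
  refine IndepFun.process_congr_left (X := fun v : Set.Iic s => fun ω => X v ω - X 0 ω) ?_
    fun v => ?_
  swap
  · filter_upwards [hX.zero] with ω hω
    simp [hω]
  refine IndepFun.process_indepFun_process (X := fun v : Set.Iic s => fun ω => X v ω - X 0 ω)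
    (Y := fun t ω => X (s + t) ω - X s ω)
    (fun v => (hX.measurable _).sub (hX.measurable _))
    (fun v => (hX.measurable _).sub (hX.measurable _)) fun I J => ?_
  -- All relevant times lie on one monotone sequence with `t m = s`: past values are sums of
  -- increments of index below `m`, future ones of index at least `m`.
  obtain ⟨t, ht, hmem⟩ := exists_monotone_nat_enum
    (insert 0 (insert s (I.image Subtype.val ∪ J.image (s + ·))))
  obtain ⟨m, hm⟩ := hmem s (by simp)
  have ht0 : t 0 = 0 := by
    obtain ⟨j, hj⟩ := hmem 0 (by simp)
    exact le_antisymm (hj ▸ ht (Nat.zero_le j)) zero_le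
  set ξ : ℕ → Ω → ℝ := fun i ω => X (t (i + 1)) ω - X (t i) ω
  have hξ : iIndepFun ξ P := hX.indep.nat ht
  have hξm : ∀ i, Measurable (ξ i) := fun i => (hX.measurable _).sub (hX.measurable _)
  have key := indep_iSup_of_disjoint (fun i => (hξm i).comap_le) hξ
    (S := Set.Iio m) (T := Set.Ici m) (Set.Iio_disjoint_Ici le_rfl)
  have hmeas : ∀ (S : Set ℕ), ∀ i ∈ S,
      Measurable[⨆ i ∈ S, MeasurableSpace.comap (ξ i) inferInstance] (ξ i) := fun S i hi =>
    Measurable.of_comap_le (le_biSup (fun i => MeasurableSpace.comap (ξ i) inferInstance) hi)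
  refine indep_of_indep_of_le_left (indep_of_indep_of_le_right key ?_) ?_
  · refine Measurable.comap_le ?_
    refine @measurable_pi_lambda _ _ _ (_) _ _ fun w => ?_
    obtain ⟨j, hj⟩ := hmem (s + w) (by
      simp only [Finset.mem_insert, Finset.mem_union, Finset.mem_image]
      exact Or.inr (Or.inr (Or.inr ⟨w, w.2, rfl⟩)))
    -- The sequence may repeat values; an index below `m` is possible only if `s + w = s`, and then
    -- `m` serves.
    obtain ⟨j', hj', hmj⟩ : ∃ j', t j' = s + w ∧ m ≤ j' := by
      rcases le_total m j with h | h
      · exact ⟨j, hj, h⟩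
      · exact ⟨m, le_antisymm (hm ▸ le_self_add) (hj ▸ ht h), le_rfl⟩
    have : (fun ω => X (s + w) ω - X s ω) = fun ω => ∑ i ∈ Finset.Ico m j', ξ i ω := by
      ext ω
      rw [← hj', ← hm]
      exact (Finset.sum_Ico_sub (fun i => X (t i) ω) hmj).symm
    rw [this]
    exact Finset.measurable_fun_sum _ fun i hi => hmeas _ i (Finset.mem_Ico.1 hi).1
  · refine Measurable.comap_le ?_
    refine @measurable_pi_lambda _ _ _ (_) _ _ fun w => ?_
    obtain ⟨j, hj⟩ := hmem (w : Set.Iic s) (by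
      simp only [Finset.mem_insert, Finset.mem_union, Finset.mem_image]
      exact Or.inr (Or.inr (Or.inl ⟨w, w.2, rfl⟩)))
    obtain ⟨j', hj', hmj⟩ : ∃ j', t j' = (w : Set.Iic s) ∧ j' ≤ m := by
      rcases le_total j m with h | h
      · exact ⟨j, hj, h⟩
      · exact ⟨m, le_antisymm (hj ▸ ht h) (hm ▸ (w : Set.Iic s).2), le_rfl⟩
    have : (fun ω => X (w : Set.Iic s) ω - X 0 ω) = fun ω => ∑ i ∈ Finset.range j', ξ i ω := by
      ext ω
      rw [← hj', ← ht0]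
      exact (Finset.sum_range_sub (fun i => X (t i) ω) j').symm
    rw [this]
    exact Finset.measurable_fun_sum _ fun i hi =>
      hmeas _ i (lt_of_lt_of_le (Finset.mem_range.1 hi) hmj)

/-- The future increments of a Lévy process have the law of the process itself. -/
lemma IsLevyProcess.map_increments [IsProbabilityMeasure P] (hX : IsLevyProcess X P) (s : ℝ≥0) :
    P.map (increments X s) = P.map (fun ω t => X t ω) := by
  have h0 : P.map (fun ω t => X t ω) = P.map (fun ω t => X t ω - X 0 ω) := by
    refine Measure.map_congr ?_
    filter_upwards [hX.zero] with ω hω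
    simp [hω]
  rw [h0]
  refine (map_eq_iff_forall_finset_map_restrict_eq (X := fun t ω => X (s + t) ω - X s ω)
    (Y := fun t ω => X t ω - X 0 ω) (hX.measurable_increments s).aemeasurable
    (measurable_pi_lambda _ fun _ =>
      (hX.measurable _).sub (hX.measurable _)).aemeasurable).2 fun I => ?_
  obtain ⟨t, ht, hmem⟩ := exists_monotone_nat_enum (insert 0 I)
  have ht0 : t 0 = 0 := by
    obtain ⟨j, hj⟩ := hmem 0 (by simp)
    exact le_antisymm (hj ▸ ht (Nat.zero_le j)) zero_le
  choose! j hj using fun u (hu : u ∈ I) => hmem u (Finset.mem_insert_of_mem hu)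
  set ξ : ℕ → Ω → ℝ := fun i ω => X (t (i + 1)) ω - X (t i) ω
  set η : ℕ → Ω → ℝ := fun i ω => X (s + t (i + 1)) ω - X (s + t i) ω
  have hξ : iIndepFun ξ P := hX.indep.nat ht
  have hη : iIndepFun η P := hX.indep.nat (t := fun i => s + t i) fun a b hab => by
    have := ht hab
    simpa using this
  have hid : ∀ i, IdentDistrib (η i) (ξ i) P P := fun i => by
    obtain ⟨d, hd⟩ := exists_add_of_le (ht (Nat.le_succ i))
    have e1 := hX.stationary (s + t i) d
    have e2 := hX.stationary (t i) d
    simp only [add_assoc, ← hd] at e1 e2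
    exact e1.trans e2.symm
  have := (IdentDistrib.pi hid hη hξ).comp
    (u := fun (w : ℕ → ℝ) (v : I) => ∑ i ∈ Finset.range (j v), w i)
    (measurable_pi_lambda _ fun v => Finset.measurable_fun_sum _ fun i _ => measurable_pi_apply i)
  convert this.map_eq using 2
  · ext ω v
    simp only [Finset.restrict_def, Function.comp, η]
    rw [Finset.sum_range_sub (fun i => X (s + t i) ω), ht0, hj v v.2, add_zero]
  · ext ω v
    simp only [Finset.restrict_def, Function.comp, ξ]
    rw [Finset.sum_range_sub (fun i => X (t i) ω), ht0, hj v v.2]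

/-- The simple Markov property with respect to the completed filtration. -/
lemma IsLevyProcess.markov [IsProbabilityMeasure P] [P.IsComplete] (hX : IsLevyProcess X P)
    (s : ℝ≥0) {A : Set Ω} (hA : MeasurableSet[completedFiltration P X hX.measurable s] A)
    {B : Set (ℝ≥0 → ℝ)} (hB : MeasurableSet B) :
    P (A ∩ increments X s ⁻¹' B) = P A * P ((fun ω t => X t ω) ⁻¹' B) := by
  obtain ⟨A', hA', hAA'⟩ := hA
  have hle : Filtration.natural X (fun s => (hX.measurable s).stronglyMeasurable) s ≤
      MeasurableSpace.comap (fun ω (v : Set.Iic s) => X v ω) MeasurableSpace.pi := by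
    refine iSup₂_le fun v hv => ?_
    refine Measurable.comap_le ?_
    have hv' : Measurable fun w : Set.Iic s → ℝ => w ⟨v, hv⟩ := measurable_pi_apply _
    exact hv'.comp (Measurable.of_comap_le le_rfl)
  have h1 : P (A ∩ increments X s ⁻¹' B) = P (A' ∩ increments X s ⁻¹' B) :=
    measure_congr (hAA'.inter (ae_eq_refl _))
  have h2 : P A = P A' := measure_congr hAA'
  rw [h1, h2, ← Measure.map_apply hX.measurable_path hB, ← hX.map_increments s,
    Measure.map_apply (hX.measurable_increments s) hB]
  exact (Indep_iff _ _ _).1 (hX.indepFun_past s) A' _ (hle _ hA') ⟨B, hB, rfl⟩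

end Markov

/-! ### Strong Markov property by grid approximation from above -/

/-- The first point of the grid `ℕ / (k + 1)` strictly after `ρ`. -/
noncomputable def gridAbove (k : ℕ) (ρ : ℝ≥0) : ℝ≥0 := (⌊(k + 1) * ρ⌋₊ + 1) / (k + 1)

lemma lt_gridAbove (k : ℕ) (ρ : ℝ≥0) : ρ < gridAbove k ρ := by
  rw [gridAbove, lt_div_iff₀ (by positivity), mul_comm]
  exact Nat.lt_floor_add_one _

lemma gridAbove_le (k : ℕ) (ρ : ℝ≥0) : gridAbove k ρ ≤ ρ + 1 / ((k : ℝ≥0) + 1) := by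
  rw [gridAbove, div_le_iff₀ (by positivity), add_mul ρ, one_div,
    inv_mul_cancel₀ (by positivity), mul_comm ρ]
  gcongr
  exact Nat.floor_le zero_le

lemma tendsto_gridAbove (ρ : ℝ≥0) :
    Tendsto (fun k => gridAbove k ρ) atTop (𝓝[≥] ρ) := by
  refine tendsto_nhdsWithin_iff.2 ⟨?_, Eventually.of_forall fun k => (lt_gridAbove k ρ).le⟩
  refine tendsto_of_tendsto_of_tendsto_of_le_of_le tendsto_const_nhds ?_
    (fun k => (lt_gridAbove k ρ).le) (fun k => gridAbove_le k ρ)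
  simpa using tendsto_const_nhds.add (tendsto_one_div_add_atTop_nhds_zero_nat (𝕜 := ℝ≥0))

section StrongMarkov

variable {Ω : Type*} [mΩ : MeasurableSpace Ω] {P : Measure Ω} {X : ℝ≥0 → Ω → ℝ}

lemma tendsto_gridAbove_path {f : ℝ≥0 → ℝ}
    (hf : ∀ t, ContinuousWithinAt f (Set.Ici t) t) (ρ t : ℝ≥0) :
    Tendsto (fun k => f (gridAbove k ρ + t)) atTop (𝓝 (f (ρ + t))) := by
  refine (hf (ρ + t)).tendsto.comp (tendsto_nhdsWithin_iff.2 ⟨?_, ?_⟩)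
  · exact ((tendsto_nhdsWithin_iff.1 (tendsto_gridAbove ρ)).1).add_const t
  · exact Eventually.of_forall fun k => add_le_add_left (lt_gridAbove k ρ).le t

lemma IsLevyProcess.rightCont (hX : IsLevyProcess X P) :
    ∀ᵐ ω ∂P, ∀ t : ℝ≥0, ContinuousWithinAt (fun s => X s ω) (Set.Ici t) t := by
  filter_upwards [hX.cadlag] with ω hω t using (hω t).1

lemma measurable_apply_nat {f : ℕ → Ω → ℝ} (hf : ∀ j, Measurable (f j)) {c : Ω → ℕ}
    (hc : Measurable c) : Measurable fun ω => f (c ω) ω := by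
  have h1 : Measurable fun p : Ω × ℕ => f p.2 p.1 := measurable_from_prod_countable_left hf
  exact h1.comp (measurable_id.prodMk hc)

lemma IsLevyProcess.measurable_eval_gridAbove (hX : IsLevyProcess X P) {ρ : Ω → ℝ≥0}
    (hρ : Measurable ρ) (k : ℕ) (t : ℝ≥0) :
    Measurable fun ω => X (gridAbove k (ρ ω) + t) ω := by
  have h2 : Measurable fun ω => ⌊((k : ℝ≥0) + 1) * ρ ω⌋₊ :=
    Nat.measurable_floor.comp (hρ.const_mul _)
  exact measurable_apply_nat (f := fun j => X (((j : ℝ≥0) + 1) / (k + 1) + t))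
    (fun j => hX.measurable _) h2

/-- An almost sure limit of evaluations at grid times; completeness of `P` upgrades a.e.
measurability to measurability. -/
lemma IsLevyProcess.measurable_eval [P.IsComplete] (hX : IsLevyProcess X P) {ρ : Ω → ℝ≥0}
    (hρ : Measurable ρ) (t : ℝ≥0) : Measurable fun ω => X (ρ ω + t) ω := by
  refine (aemeasurable_iff_measurable (μ := P)).1 (aemeasurable_of_tendsto_metrizable_ae atTop
    (fun k => (hX.measurable_eval_gridAbove hρ k t).aemeasurable) ?_)
  filter_upwards [hX.rightCont] with ω hω using tendsto_gridAbove_path hω _ _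

lemma IsLevyProcess.measurable_postIncrements [P.IsComplete] (hX : IsLevyProcess X P)
    {ρ : Ω → ℝ≥0} (hρ : Measurable ρ) : Measurable fun ω => increments X (ρ ω) ω :=
  measurable_pi_lambda _ fun t => (hX.measurable_eval hρ t).sub
    (by simpa using hX.measurable_eval hρ 0)

lemma IsLevyProcess.measurableSet_of_inter_lt [P.IsComplete] (hX : IsLevyProcess X P) {ρ : Ω → ℝ≥0} {A : Set Ω}
    (hA : ∀ t, MeasurableSet[completedFiltration P X hX.measurable t] (A ∩ {ω | ρ ω < t})) :
    MeasurableSet A := by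
  have : A = ⋃ n : ℕ, A ∩ {ω | ρ ω < n} := by
    ext ω
    simp only [Set.mem_iUnion, Set.mem_inter_iff, Set.mem_ofPred_eq, exists_and_left]
    exact ⟨fun h => ⟨h, exists_nat_gt _⟩, fun h => h.1⟩
  rw [this]
  exact MeasurableSet.iUnion fun n => (completedFiltration P X hX.measurable).le _ _ (hA n)

variable [IsProbabilityMeasure P] [P.IsComplete]

/-- The grid time takes countably many values, and since it lies strictly after `ρ`, each value is
recognised by the time it occurs. The simple Markov property applies on each piece, and the pieces
add up. Only events `ρ < t` are used, so `ρ` need not be a stopping time. -/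
lemma IsLevyProcess.strongMarkov_grid (hX : IsLevyProcess X P) {ρ : Ω → ℝ≥0} {A : Set Ω}
    (hA : ∀ t, MeasurableSet[completedFiltration P X hX.measurable t] (A ∩ {ω | ρ ω < t}))
    (k : ℕ) {B : Set (ℝ≥0 → ℝ)} (hB : MeasurableSet B) :
    P (A ∩ {ω | increments X (gridAbove k (ρ ω)) ω ∈ B}) =
      P A * P ((fun ω t => X t ω) ⁻¹' B) := by
  set F := completedFiltration P X hX.measurable
  set c : ℕ → ℝ≥0 := fun j => j / (k + 1)
  set D : ℕ → Set Ω := fun j => A ∩ {ω | ⌊(k + 1) * ρ ω⌋₊ = j}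
  have hc : Monotone c := fun a b hab => by
    simp only [c]
    gcongr
  have hD : ∀ j, MeasurableSet[F (c (j + 1))] (D j) := by
    intro j
    have : D j = (A ∩ {ω | ρ ω < c (j + 1)}) \ (A ∩ {ω | ρ ω < c j}) := by
      ext ω
      simp only [D, c, Set.mem_inter_iff, Set.mem_ofPred_eq, Set.mem_sdiff, not_and, not_lt]
      rw [Nat.floor_eq_iff zero_le, lt_div_iff₀ (by positivity), div_le_iff₀ (by positivity),
        mul_comm (ρ ω)]
      push_cast
      tauto
    rw [this]
    exact (hA _).diff (F.mono (hc (Nat.le_succ j)) _ (hA _))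
  have hDm : ∀ j, MeasurableSet (D j) := fun j => F.le _ _ (hD j)
  have hdisj : Pairwise (Function.onFun Disjoint D) := fun i j hij =>
    Set.disjoint_left.2 fun ω hi hj => hij (hi.2.symm.trans hj.2)
  have h1 : A = ⋃ j, D j := by
    ext ω
    simp [D]
  have h2 : A ∩ {ω | increments X (gridAbove k (ρ ω)) ω ∈ B} =
      ⋃ j, D j ∩ increments X (c (j + 1)) ⁻¹' B := by
    ext ω
    simp only [D, c, Set.mem_inter_iff, Set.mem_ofPred_eq, Set.mem_iUnion, Set.mem_preimage,
      gridAbove, Nat.cast_add, Nat.cast_one]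
    constructor
    · rintro ⟨h, h'⟩
      exact ⟨_, ⟨h, rfl⟩, h'⟩
    · rintro ⟨j, ⟨h, rfl⟩, h'⟩
      exact ⟨h, h'⟩
  rw [h2, measure_iUnion
    (fun i j hij => (hdisj hij).mono Set.inter_subset_left Set.inter_subset_left)
    fun j => (hDm j).inter (hX.measurable_increments _ hB)]
  simp_rw [fun j => hX.markov (c (j + 1)) (hD j) hB]
  rw [ENNReal.tsum_mul_right, ← measure_iUnion hdisj hDm, ← h1]

/-- The strong Markov property at an optional time `ρ`: on an event `A` of its past, the
increments after `ρ` are distributed as the process itself. -/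
lemma IsLevyProcess.strongMarkov (hX : IsLevyProcess X P) {ρ : Ω → ℝ≥0} (hρ : Measurable ρ)
    {A : Set Ω}
    (hA : ∀ t, MeasurableSet[completedFiltration P X hX.measurable t] (A ∩ {ω | ρ ω < t})) :
    (P.restrict A).map (fun ω => increments X (ρ ω) ω) = P A • P.map (fun ω t => X t ω) := by
  have hAm := hX.measurableSet_of_inter_lt hA
  have hY := hX.measurable_postIncrements hρ
  have hYk : ∀ k, Measurable fun ω => increments X (gridAbove k (ρ ω)) ω := fun k =>
    measurable_pi_lambda _ fun t => (hX.measurable_eval_gridAbove hρ k t).sub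
      (by simpa using hX.measurable_eval_gridAbove hρ k 0)
  have hgrid : ∀ k, (P.restrict A).map (fun ω => increments X (gridAbove k (ρ ω)) ω) =
      P A • P.map (fun ω t => X t ω) := by
    intro k
    ext B hB
    rw [Measure.map_apply (hYk k) hB, Measure.restrict_apply (hYk k hB), Set.inter_comm,
      Measure.smul_apply, Measure.map_apply hX.measurable_path hB]
    exact hX.strongMarkov_grid hA k hB
  have hfin : IsFiniteMeasure (P A • P.map fun ω t => X t ω) :=
    Measure.smul_finite _ (measure_ne_top P A)
  -- Finite-dimensional marginals determine the law on path space; for them, bounded continuous test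
  -- functions carry the grid identity to the limit by right-continuity.
  refine IsProjectiveLimit.unique (P := fun I : Finset ℝ≥0 =>
    (P A • P.map (fun ω t => X t ω)).map I.restrict) (fun I => ?_) (fun I => rfl)
  refine ext_of_forall_integral_eq_of_IsFiniteMeasure fun f => ?_
  have hI : Measurable (I.restrict : (ℝ≥0 → ℝ) → I → ℝ) := Finset.measurable_restrict _
  have hf : ∀ {μ : Measure (I → ℝ)}, AEStronglyMeasurable f μ :=
    f.continuous.aestronglyMeasurable
  have hlim : Tendsto (fun k => ∫ ω in A, f (I.restrict (increments X (gridAbove k (ρ ω)) ω)) ∂P)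
      atTop (𝓝 (∫ ω in A, f (I.restrict (increments X (ρ ω) ω)) ∂P)) := by
    refine tendsto_integral_of_dominated_convergence (fun _ => ‖f‖)
      (fun k => (f.continuous.measurable.comp (hI.comp (hYk k))).aestronglyMeasurable)
      (integrable_const _) (fun k => Eventually.of_forall fun ω => f.norm_coe_le_norm _) ?_
    filter_upwards [ae_restrict_of_ae hX.rightCont] with ω hω
    refine (f.continuous.tendsto _).comp (tendsto_pi_nhds.2 fun t => ?_)
    have h0 := tendsto_gridAbove_path hω (ρ ω) 0
    simp only [add_zero] at h0
    exact (tendsto_gridAbove_path hω (ρ ω) t).sub h0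
  have hconst : ∀ k, ∫ ω in A, f (I.restrict (increments X (gridAbove k (ρ ω)) ω)) ∂P =
      ∫ w, f w ∂((P A • P.map (fun ω t => X t ω)).map I.restrict) := by
    intro k
    rw [← hgrid k, integral_map hI.aemeasurable hf, integral_map (hYk k).aemeasurable]
    exact (f.continuous.measurable.comp hI).aestronglyMeasurable
  simp_rw [hconst] at hlim
  rw [tendsto_nhds_unique tendsto_const_nhds hlim, integral_map hI.aemeasurable hf,
    integral_map hY.aemeasurable]
  exact (f.continuous.measurable.comp hI).aestronglyMeasurable

end StrongMarkov

/-! ### Passage times and quasi-left-continuity at `0` -/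

/-- A dense sequence of times. -/
noncomputable abbrev denseTime : ℕ → ℝ≥0 := TopologicalSpace.denseSeq ℝ≥0

lemma exists_denseTime_btwn {a b : ℝ≥0} (hab : a < b) : ∃ j, a < denseTime j ∧ denseTime j < b := by
  obtain ⟨_, ⟨j, rfl⟩, h⟩ := (TopologicalSpace.denseRange_denseSeq ℝ≥0).exists_between hab
  exact ⟨j, h⟩

lemma exists_denseTime_mem_of_rightCont {f : ℝ≥0 → ℝ} {a b : ℝ≥0}
    (hf : ContinuousWithinAt f (Set.Ici a) a) {U : Set ℝ} (hU : IsOpen U) (ha : f a ∈ U)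
    (hab : a < b) : ∃ j, a < denseTime j ∧ denseTime j < b ∧ f (denseTime j) ∈ U := by
  have h1 : ∀ᶠ s in 𝓝[>] a, f s ∈ U :=
    (hf.mono Set.Ioi_subset_Ici_self).eventually (hU.mem_nhds ha)
  obtain ⟨c, hc, hcU⟩ := (mem_nhdsGT_iff_exists_Ioo_subset' hab).1 h1
  obtain ⟨j, hj1, hj2⟩ := exists_denseTime_btwn (lt_min hc hab)
  exact ⟨j, hj1, hj2.trans_le (min_le_right _ _), hcU ⟨hj1, hj2.trans_le (min_le_left _ _)⟩⟩

lemma apply_sInf_le_of_rightCont {f : ℝ≥0 → ℝ} {c : ℝ} (hne : ∃ s, f s < c)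
    (hf : ContinuousWithinAt f (Set.Ici (sInf {s | f s < c})) (sInf {s | f s < c})) :
    f (sInf {s | f s < c}) ≤ c := by
  by_contra! h
  set a := sInf {s | f s < c} with ha
  obtain ⟨d, hd, hdU⟩ := mem_nhdsGE_iff_exists_Ico_subset.1 (hf.eventually (isOpen_Ioi.mem_nhds h))
  obtain ⟨s, hs, hsd⟩ := exists_lt_of_csInf_lt (s := {s | f s < c}) hne hd
  have h1 : f s < c := hs
  have h2 : c < f s := hdU ⟨csInf_le (OrderBot.bddBelow _) hs, hsd⟩
  exact lt_asymm h1 h2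

section

variable {Ω : Type*} [mΩ : MeasurableSpace Ω] {P : Measure Ω} {X : ℝ≥0 → Ω → ℝ}
  [P.IsComplete]

lemma measurableSet_completedFiltration_congr {hX : ∀ t, Measurable (X t)} {t : ℝ≥0} {A B : Set Ω}
    (hA : MeasurableSet[completedFiltration P X hX t] A) (h : ∀ᵐ ω ∂P, ω ∈ B ↔ ω ∈ A) :
    MeasurableSet[completedFiltration P X hX t] B :=
  EventuallyMeasurableSet.congr hA (eventuallyEq_set.2 h)

lemma measurable_completedFiltration (hX : ∀ t, Measurable (X t)) {s t : ℝ≥0} (hst : s ≤ t) :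
    Measurable[completedFiltration P X hX t] (X s) := by
  refine Measurable.mono (ma := Filtration.natural X (fun s => (hX s).stronglyMeasurable) t)
    ?_ le_eventuallyMeasurableSpace le_rfl
  exact Measurable.of_comap_le
    (le_iSup₂_of_le (f := fun j (_ : j ≤ t) => MeasurableSpace.comap (X j) _) s hst le_rfl)

/-- Since `(-∞, c)` is open, right-continuity lets `s` range over dense times below `t`, up to a
null set absorbed by the completion. -/
lemma IsLevyProcess.measurableSet_exists_lt (hX : IsLevyProcess X P) (x c : ℝ) (t : ℝ≥0) :
    MeasurableSet[completedFiltration P X hX.measurable t]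
      {ω | ∃ s < t, x + X s ω < c} := by
  have h : MeasurableSet[completedFiltration P X hX.measurable t]
      (⋃ j : {j // denseTime j < t}, {ω | x + X (denseTime j) ω < c}) := by
    refine MeasurableSet.iUnion fun j => ?_
    exact ((measurable_completedFiltration hX.measurable j.2.le).const_add x) measurableSet_Iio
  refine measurableSet_completedFiltration_congr h ?_
  filter_upwards [hX.rightCont] with ω hω
  simp only [Set.mem_ofPred_eq, Set.mem_iUnion, Subtype.exists, exists_prop]
  constructor
  · rintro ⟨s, hst, hs⟩
    obtain ⟨j, -, hj, hjc⟩ := exists_denseTime_mem_of_rightCont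
      (continuousWithinAt_const.add (hω s) : ContinuousWithinAt (fun s => x + X s ω) _ _)
      (isOpen_Iio (a := c)) hs hst
    exact ⟨j, hj, hjc⟩
  · rintro ⟨j, hj, h⟩
    exact ⟨_, hj, h⟩

/-- The first time the shifted process falls below the level `c`. -/
noncomputable def passageTime (X : ℝ≥0 → Ω → ℝ) (x c : ℝ) (ω : Ω) : ℝ≥0 :=
  sInf {s | x + X s ω < c}

omit [P.IsComplete] mΩ in
lemma passageTime_lt_iff {x c : ℝ} {ω : Ω} (h : ∃ s, x + X s ω < c) {t : ℝ≥0} :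
    passageTime X x c ω < t ↔ ∃ s < t, x + X s ω < c := by
  rw [passageTime, csInf_lt_iff (s := {s | x + X s ω < c}) (OrderBot.bddBelow _) h]
  exact ⟨fun ⟨s, h1, h2⟩ => ⟨s, h2, h1⟩, fun ⟨s, h1, h2⟩ => ⟨s, h2, h1⟩⟩

/-- The intersection excludes paths without passage, where `sInf ∅ = 0` makes the passage time
spuriously zero. The result is the hypothesis of `strongMarkov`. -/
lemma IsLevyProcess.measurableSet_passage_lt (hX : IsLevyProcess X P) (x c : ℝ) (t : ℝ≥0) :
    MeasurableSet[completedFiltration P X hX.measurable t]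
      ({ω | ∃ s, x + X s ω < c} ∩ {ω | passageTime X x c ω < t}) := by
  convert hX.measurableSet_exists_lt x c t using 1
  ext ω
  constructor
  · rintro ⟨h, h'⟩
    exact (passageTime_lt_iff h).1 h'
  · rintro ⟨s, hs, h⟩
    exact ⟨⟨s, h⟩, (passageTime_lt_iff ⟨s, h⟩).2 ⟨s, hs, h⟩⟩

lemma IsLevyProcess.measurable_passageTime (hX : IsLevyProcess X P) (x c : ℝ) :
    Measurable (passageTime X x c) := by
  have hA := hX.measurableSet_of_inter_lt (hX.measurableSet_passage_lt x c)
  refine measurable_of_Iio fun t => ?_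
  have : passageTime X x c ⁻¹' Set.Iio t =
      ({ω | ∃ s, x + X s ω < c} ∩ {ω | passageTime X x c ω < t}) ∪
        ({ω | ∃ s, x + X s ω < c}ᶜ ∩ {_ω | 0 < t}) := by
    ext ω
    by_cases h : ∃ s, x + X s ω < c
    · simp [h]
    · have h0 : passageTime X x c ω = 0 := by
        have : {s | x + X s ω < c} = ∅ := Set.eq_empty_iff_forall_notMem.2 fun s hs => h ⟨s, hs⟩
        simp [passageTime, this]
      simp only [Set.mem_preimage, Set.mem_Iio, h0, Set.mem_union, Set.mem_inter_iff,
        Set.mem_ofPred_eq, h, false_and, Set.mem_compl_iff, not_false_eq_true, true_and, false_or]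
  rw [this]
  exact ((completedFiltration P X hX.measurable).le _ _ (hX.measurableSet_passage_lt x c t)).union
    (hA.compl.inter (MeasurableSet.const _))

/-- The paths exceeding `ε` before time `1 / (k + 1)`. -/
def earlyExcursion (ε : ℝ) (k : ℕ) : Set (ℝ≥0 → ℝ) :=
  {w | ∃ j, denseTime j < 1 / (k + 1) ∧ ε < w (denseTime j)}

lemma measurableSet_earlyExcursion (ε : ℝ) (k : ℕ) : MeasurableSet (earlyExcursion ε k) := by
  have : earlyExcursion ε k = ⋃ j, {_w : ℝ≥0 → ℝ | denseTime j < 1 / (k + 1)} ∩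
      {w | ε < w (denseTime j)} := by
    ext w
    simp [earlyExcursion]
  rw [this]
  exact MeasurableSet.iUnion fun j => (MeasurableSet.const _).inter
    (measurable_pi_apply _ measurableSet_Ioi)

-- The events decrease in `k`, and right-continuity at `0` with `X 0 = 0` makes their intersection
-- null.
omit [P.IsComplete] in
lemma IsLevyProcess.tendsto_measure_earlyExcursion [IsFiniteMeasure P] (hX : IsLevyProcess X P)
    {ε : ℝ} (hε : 0 < ε) :
    Tendsto (fun k => P ((fun ω t => X t ω) ⁻¹' earlyExcursion ε k)) atTop (𝓝 0) := by
  have hanti : Antitone fun k => (fun ω t => X t ω) ⁻¹' earlyExcursion ε k := by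
    rintro k l hkl ω ⟨j, hj, h⟩
    refine ⟨j, hj.trans_le ?_, h⟩
    gcongr
  have := tendsto_measure_iInter_atTop (μ := P)
    (fun k => (hX.measurable_path (measurableSet_earlyExcursion ε k)).nullMeasurableSet) hanti
    ⟨0, measure_ne_top _ _⟩
  suffices hzero : P (⋂ k, (fun ω t => X t ω) ⁻¹' earlyExcursion ε k) = 0 by
    rwa [hzero] at this
  rw [measure_eq_zero_iff_ae_notMem]
  filter_upwards [hX.rightCont, hX.zero] with ω hω h0 hmem
  have hev : ∀ᶠ s in 𝓝[≥] (0 : ℝ≥0), X s ω < ε :=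
    (hω 0).eventually (isOpen_Iio.mem_nhds (show X 0 ω < ε by rwa [h0]))
  obtain ⟨d, hd, hdU⟩ := mem_nhdsGE_iff_exists_Ico_subset.1 hev
  obtain ⟨k, hk'⟩ := exists_nat_one_div_lt (NNReal.coe_pos.2 hd)
  have hk : 1 / ((k : ℝ≥0) + 1) < d := by exact_mod_cast hk'
  obtain ⟨j, hj, h⟩ := Set.mem_iInter.1 hmem k
  exact lt_asymm h (hdU ⟨zero_le, hj.trans hk⟩)

omit mΩ in
/-- A right-continuous positive path approaching `0` from the left in finite time makes, from
its passage times below small levels, large excursions in arbitrarily short time. -/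
lemma eventually_earlyExcursion {x : ℝ} {ω : Ω} {T : ℝ≥0}
    (hω : ∀ t : ℝ≥0, ContinuousWithinAt (fun s => X s ω) (Set.Ici t) t)
    (hT : ∀ n : ℕ, ∃ s ≤ T, x + X s ω < 1 / (n + 1)) (hpos : ∀ s ≤ T, 0 < x + X s ω) :
    ∃ m : ℕ, ∀ k, ∃ N : ℕ, ∀ n ≥ N,
      increments X (passageTime X x (1 / ((n : ℝ) + 1)) ω) ω ∈
        earlyExcursion (1 / ((m : ℝ) + 1)) k := by
  set r : ℕ → ℝ≥0 := fun n => passageTime X x (1 / ((n : ℝ) + 1)) ω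
  have hr : Monotone r := fun a b hab => by
    obtain ⟨s, -, hs⟩ := hT b
    refine csInf_le_csInf (OrderBot.bddBelow _) ⟨s, hs⟩ fun u hu =>
      lt_of_lt_of_le (show x + X u ω < 1 / ((b : ℝ) + 1) from hu) ?_
    gcongr
  have hrT : ∀ n, r n ≤ T := fun n => by
    obtain ⟨s, hsT, hs⟩ := hT n
    have h : r n ≤ s := csInf_le (OrderBot.bddBelow _) hs
    exact h.trans hsT
  have hbdd : BddAbove (Set.range r) := ⟨T, by rintro _ ⟨n, rfl⟩; exact hrT n⟩
  have hlim := tendsto_atTop_ciSup hr hbdd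
  set σ := ⨆ n, r n
  have hrσ : ∀ n, r n ≤ σ := le_ciSup hbdd
  have hσ := hpos σ (ciSup_le hrT)
  have hXr : ∀ n, x + X (r n) ω ≤ 1 / ((n : ℝ) + 1) := fun n => by
    obtain ⟨s, -, hs⟩ := hT n
    exact apply_sInf_le_of_rightCont (f := fun s => x + X s ω) ⟨s, hs⟩
      (continuousWithinAt_const.add (hω _))
  -- The limit `σ` of the passage times has level above `2 / (m + 1)`, whereas for `n ≥ m` the level
  -- at the `n`-th passage is at most `1 / (m + 1)`: the rise exceeds `1 / (m + 1)`.
  obtain ⟨m, hm⟩ := exists_nat_one_div_lt (half_pos hσ)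
  refine ⟨m, fun k => ?_⟩
  have hk : σ < σ + 1 / ((k : ℝ≥0) + 1) := lt_add_of_pos_right _ (by positivity)
  have hnear : ∀ᶠ n in atTop, σ < r n + 1 / ((k : ℝ≥0) + 1) :=
    (hlim.add_const _).eventually (lt_mem_nhds hk)
  obtain ⟨N, hN⟩ := eventually_atTop.1 hnear
  refine ⟨max N m, fun n hn => ?_⟩
  obtain ⟨d, hd⟩ := exists_add_of_le (hrσ n)
  have hdk : d < 1 / ((k : ℝ≥0) + 1) := by
    have := hN n ((le_max_left _ _).trans hn)
    rw [hd] at this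
    exact lt_of_add_lt_add_left this
  have hcont : ContinuousWithinAt (fun s => X (r n + s) ω - X (r n) ω) (Set.Ici d) d := by
    refine ContinuousWithinAt.sub ?_ continuousWithinAt_const
    refine (hω (r n + d)).comp (t := Set.Ici (r n + d)) (f := fun s => r n + s)
      (by fun_prop) fun s hs => ?_
    exact add_le_add_right (Set.mem_Ici.1 hs) _
  have hjump : X (r n + d) ω - X (r n) ω ∈ Set.Ioi (1 / ((m : ℝ) + 1)) := by
    rw [← hd, Set.mem_Ioi]
    have h1 : 1 / ((n : ℝ) + 1) ≤ 1 / ((m : ℝ) + 1) := by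
      have : m ≤ n := (le_max_right _ _).trans hn
      gcongr
    linarith [hXr n]
  obtain ⟨j, -, hj, hjm⟩ := exists_denseTime_mem_of_rightCont hcont isOpen_Ioi hjump hdk
  exact ⟨j, hj, hjm⟩

/-- Quasi-left-continuity at `0`: almost surely, the shifted process cannot approach the half-line
`(-∞, 0]` without entering it. -/
theorem IsLevyProcess.ae_exists_le_zero [IsProbabilityMeasure P] (hX : IsLevyProcess X P) (x : ℝ) :
    ∀ᵐ ω ∂P, ∀ T : ℝ≥0, (∀ n : ℕ, ∃ s ≤ T, x + X s ω < 1 / (n + 1)) →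
      ∃ s ≤ T, x + X s ω ≤ 0 := by
  set G : ℕ → ℕ → ℕ → Set Ω := fun m k n =>
    {ω | ∃ s, x + X s ω < 1 / ((n : ℝ) + 1)} ∩
      (fun ω => increments X (passageTime X x (1 / ((n : ℝ) + 1)) ω) ω) ⁻¹'
        earlyExcursion (1 / ((m : ℝ) + 1)) k
  have hG : ∀ m k n, P (G m k n) ≤
      P ((fun ω t => X t ω) ⁻¹' earlyExcursion (1 / ((m : ℝ) + 1)) k) := by
    intro m k n
    have hρ := hX.measurable_passageTime x (1 / ((n : ℝ) + 1))
    have hE := measurableSet_earlyExcursion (1 / ((m : ℝ) + 1)) k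
    have h := congrArg (fun μ => μ (earlyExcursion (1 / ((m : ℝ) + 1)) k))
      (hX.strongMarkov hρ (hX.measurableSet_passage_lt x (1 / ((n : ℝ) + 1))))
    simp only [Measure.smul_apply, smul_eq_mul] at h
    rw [Measure.map_apply (hX.measurable_postIncrements hρ) hE,
      Measure.restrict_apply (hX.measurable_postIncrements hρ hE), Set.inter_comm,
      Measure.map_apply hX.measurable_path hE] at h
    rw [h]
    exact mul_le_of_le_one_left' prob_le_one
  have hnull : ∀ m, P (⋂ k, ⋃ N, ⋂ n ≥ N, G m k n) = 0 := by
    intro m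
    -- For fixed `k` the bound `hG` is uniform in `n`, so it survives the lower limit over `n`; only
    -- then does `k` tend to infinity.
    refine le_antisymm (ge_of_tendsto' (hX.tendsto_measure_earlyExcursion
      (ε := 1 / ((m : ℝ) + 1)) (by positivity)) fun k => ?_) zero_le
    refine (measure_mono (Set.iInter_subset _ k)).trans ?_
    have hmono : Monotone fun N => ⋂ n ≥ N, G m k n := fun a b hab =>
      Set.biInter_mono (fun n hn => hab.trans hn) fun n _ => le_rfl
    rw [hmono.measure_iUnion]
    exact iSup_le fun N => (measure_mono (Set.biInter_subset_of_mem (le_refl N))).trans (hG m k N)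
  filter_upwards [hX.rightCont, measure_eq_zero_iff_ae_notMem.1 (measure_iUnion_null hnull)]
    with ω hω hbad T hT
  by_contra! hpos
  obtain ⟨m, hm⟩ := eventually_earlyExcursion hω hT hpos
  refine hbad (Set.mem_iUnion.2 ⟨m, Set.mem_iInter.2 fun k => ?_⟩)
  obtain ⟨N, hN⟩ := hm k
  refine Set.mem_iUnion.2 ⟨N, Set.mem_iInter₂.2 fun n hn => ⟨?_, hN n hn⟩⟩
  obtain ⟨s, -, hs⟩ := hT n
  exact ⟨s, hs⟩

end

/-! ### Discount factors and closed form of the premium leg -/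

section Discount

variable {r : ℝ}

@[simp] lemma discount_top : discount r ⊤ = 0 := rfl

@[simp] lemma discount_coe (t : ℝ≥0) : discount r (t : WithTop ℝ≥0) = Real.exp (-(r * t)) := rfl

lemma discount_nonneg (t : WithTop ℝ≥0) : 0 ≤ discount r t := by
  cases t with
  | top => simp
  | coe t => exact (Real.exp_pos _).le

lemma discount_antitone (hr : 0 < r) : Antitone (discount r) := by
  intro a b hab
  cases b with
  | top => simpa using discount_nonneg a
  | coe b =>
    lift a to ℝ≥0 using (hab.trans_lt (WithTop.coe_lt_top b)).ne
    simp only [discount_coe, Real.exp_le_exp, neg_le_neg_iff]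
    have : (a : ℝ) ≤ b := by exact_mod_cast hab
    gcongr

lemma discount_zero : discount r 0 = 1 := by
  change discount r ((0 : ℝ≥0) : WithTop ℝ≥0) = 1
  rw [discount_coe, NNReal.coe_zero, mul_zero, neg_zero, Real.exp_zero]

lemma discount_le_one (hr : 0 < r) (t : WithTop ℝ≥0) : discount r t ≤ 1 :=
  (discount_antitone hr (bot_le : (0 : WithTop ℝ≥0) ≤ t)).trans_eq discount_zero

lemma measurable_discount : Measurable (discount r) :=
  WithTop.measurable_of_measurable_comp_coe (by simp only [discount_coe]; fun_prop)

lemma integral_Ioi_exp_neg_mul (hr : 0 < r) (a : ℝ) :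
    IntegrableOn (fun t => Real.exp (-(r * t))) (Set.Ioi a) ∧
      ∫ t in Set.Ioi a, Real.exp (-(r * t)) = Real.exp (-(r * a)) / r := by
  have h1 := integrableOn_exp_mul_Ioi (neg_lt_zero.2 hr) a
  have h2 := integral_exp_mul_Ioi (neg_lt_zero.2 hr) a
  simp only [neg_mul, neg_div_neg_eq] at h1 h2
  exact ⟨h1, h2⟩

lemma premiumLeg_eq (hr : 0 < r) (c : ℝ) {a b : WithTop ℝ≥0} (hab : a ≤ b) :
    premiumLeg r c a b = c / r * (discount r a - discount r b) := by
  rw [premiumLeg, integral_mul_const]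
  cases a with
  | top =>
    obtain rfl : b = ⊤ := top_le_iff.1 hab
    simp only [not_top_lt, false_and, and_false, sub_self, mul_zero]
    simp
  | coe a =>
    have hlt : ∀ t : ℝ, 0 ≤ t → ((a : WithTop ℝ≥0) < (t.toNNReal : WithTop ℝ≥0) ↔ (a : ℝ) < t) :=
      fun t ht => by
        rw [WithTop.coe_lt_coe, ← NNReal.coe_lt_coe, Real.coe_toNNReal t ht]
    cases b with
    | top =>
      have : {t : ℝ | 0 ≤ t ∧ (a : WithTop ℝ≥0) < (t.toNNReal : WithTop ℝ≥0) ∧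
          (t.toNNReal : WithTop ℝ≥0) ≤ ⊤} = Set.Ioi (a : ℝ) := by
        ext t
        simp only [le_top, and_true, Set.mem_ofPred_eq, Set.mem_Ioi]
        exact ⟨fun h => (hlt t h.1).1 h.2,
          fun h => ⟨a.2.trans h.le, (hlt t (a.2.trans h.le)).2 h⟩⟩
      rw [this, (integral_Ioi_exp_neg_mul hr _).2, discount_coe, discount_top]
      ring
    | coe b =>
      have hle : ∀ t : ℝ, 0 ≤ t →
          ((t.toNNReal : WithTop ℝ≥0) ≤ (b : WithTop ℝ≥0) ↔ t ≤ b) := fun t ht => by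
        rw [WithTop.coe_le_coe, ← NNReal.coe_le_coe, Real.coe_toNNReal t ht]
      have hab' : (a : ℝ) ≤ b := by exact_mod_cast hab
      have : {t : ℝ | 0 ≤ t ∧ (a : WithTop ℝ≥0) < (t.toNNReal : WithTop ℝ≥0) ∧
          (t.toNNReal : WithTop ℝ≥0) ≤ b} = Set.Ioi (a : ℝ) \ Set.Ioi (b : ℝ) := by
        ext t
        simp only [Set.mem_ofPred_eq, Set.mem_sdiff, Set.mem_Ioi, not_lt]
        exact ⟨fun h => ⟨(hlt t h.1).1 h.2.1, (hle t h.1).1 h.2.2⟩,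
          fun h => ⟨a.2.trans h.1.le, (hlt t (a.2.trans h.1.le)).2 h.1,
            (hle t (a.2.trans h.1.le)).2 h.2⟩⟩
      rw [this, setIntegral_sdiff measurableSet_Ioi (integral_Ioi_exp_neg_mul hr _).1
        (Set.Ioi_subset_Ioi hab'), (integral_Ioi_exp_neg_mul hr _).2,
        (integral_Ioi_exp_neg_mul hr _).2, discount_coe, discount_coe]
      ring

end Discount

/-! ### Discount at default as a measurable functional of the path -/

/-- The path `y + w` comes arbitrarily close to `(-∞, 0]` before the `j`-th dense time. -/
def approachSet (j : ℕ) : Set (ℝ × (ℝ≥0 → ℝ)) :=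
  {p | ∀ n : ℕ, ∃ i, denseTime i ≤ denseTime j ∧ p.1 + p.2 (denseTime i) < 1 / (n + 1)}

lemma measurableSet_approachSet (j : ℕ) : MeasurableSet (approachSet j) := by
  have : approachSet j = ⋂ n : ℕ, ⋃ i, {_p | denseTime i ≤ denseTime j} ∩
      {p : ℝ × (ℝ≥0 → ℝ) | p.1 + p.2 (denseTime i) < 1 / (n + 1)} := by
    ext p
    simp [approachSet]
  rw [this]
  refine MeasurableSet.iInter fun n => MeasurableSet.iUnion fun i =>
    (MeasurableSet.const _).inter (measurableSet_lt ?_ measurable_const)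
  exact measurable_fst.add ((measurable_pi_apply _).comp measurable_snd)

open Classical in
/-- The discount factor at the default time of the path `y + w`, as a measurable functional. -/
noncomputable def defaultDiscount (r : ℝ) (p : ℝ × (ℝ≥0 → ℝ)) : ℝ :=
  ⨆ j, if p ∈ approachSet j then discount r (denseTime j) else 0

lemma measurable_defaultDiscount (r : ℝ) : Measurable (defaultDiscount r) :=
  Measurable.iSup fun j => Measurable.ite (measurableSet_approachSet j)
    measurable_const measurable_const

section

variable {r : ℝ} (hr : 0 < r)
include hr

open Classical in
lemma defaultDiscount_term_mem (p : ℝ × (ℝ≥0 → ℝ)) (j : ℕ) :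
    (if p ∈ approachSet j then discount r (denseTime j) else 0) ∈ Set.Icc (0 : ℝ) 1 := by
  split_ifs
  · exact ⟨discount_nonneg _, discount_le_one hr _⟩
  · simp

lemma defaultDiscount_mem (p : ℝ × (ℝ≥0 → ℝ)) : defaultDiscount r p ∈ Set.Icc (0 : ℝ) 1 :=
  ⟨Real.iSup_nonneg fun j => (defaultDiscount_term_mem hr p j).1,
    ciSup_le fun j => (defaultDiscount_term_mem hr p j).2⟩

lemma discount_le_defaultDiscount {p : ℝ × (ℝ≥0 → ℝ)} {j : ℕ} (h : p ∈ approachSet j) :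
    discount r (denseTime j) ≤ defaultDiscount r p := by
  refine le_ciSup_of_le ⟨1, ?_⟩ j (by rw [if_pos h])
  rintro _ ⟨i, rfl⟩
  exact (defaultDiscount_term_mem hr p i).2

end

section

variable {Ω : Type*} {X : ℝ≥0 → Ω → ℝ} {x : ℝ} {ω : Ω}

lemma defaultTime_le_of_le_zero {s : ℝ≥0} (hs : x + X s ω ≤ 0) : defaultTime X x ω ≤ s :=
  hittingAfter_le_of_mem zero_le hs

lemma apply_sInf_le_zero_of_rightCont {f : ℝ≥0 → ℝ} (hne : ∃ s, f s ≤ 0)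
    (hf : ContinuousWithinAt f (Set.Ici (sInf {s | f s ≤ 0})) (sInf {s | f s ≤ 0})) :
    f (sInf {s | f s ≤ 0}) ≤ 0 := by
  by_contra! h
  set a := sInf {s | f s ≤ 0} with ha
  obtain ⟨d, hd, hdU⟩ := mem_nhdsGE_iff_exists_Ico_subset.1 (hf.eventually (isOpen_Ioi.mem_nhds h))
  obtain ⟨s, hs, hsd⟩ := exists_lt_of_csInf_lt (s := {s | f s ≤ 0}) hne hd
  have h1 : f s ≤ 0 := hs
  have h2 : 0 < f s := hdU ⟨csInf_le (OrderBot.bddBelow _) hs, hsd⟩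
  exact h1.not_gt h2

lemma le_zero_of_defaultTime_eq
    (hω : ∀ t : ℝ≥0, ContinuousWithinAt (fun s => X s ω) (Set.Ici t) t) {t : ℝ≥0}
    (h : defaultTime X x ω = t) : x + X t ω ≤ 0 := by
  have hne : ∃ s, x + X s ω ≤ 0 := by
    by_contra! hcon
    have : defaultTime X x ω = ⊤ := hittingAfter_eq_top_iff.2 fun j _ hj =>
      (hcon j).not_ge (show x + X j ω ≤ 0 from hj)
    exact WithTop.top_ne_coe (this.symm.trans h)
  have hdef : defaultTime X x ω = (sInf {s | x + X s ω ≤ 0} : ℝ≥0) := by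
    rw [defaultTime, hittingAfter_def]
    obtain ⟨s, hs⟩ := hne
    simp only
    rw [if_pos ⟨s, zero_le, hs⟩]
    simp [shifted]
    rfl
  rw [hdef, WithTop.coe_inj] at h
  rw [← h]
  exact apply_sInf_le_zero_of_rightCont (f := fun s => x + X s ω) hne
    (continuousWithinAt_const.add (hω _))

lemma defaultTime_le_iff (hω : ∀ t : ℝ≥0, ContinuousWithinAt (fun s => X s ω) (Set.Ici t) t)
    {t : ℝ≥0} : defaultTime X x ω ≤ t ↔ ∃ s ≤ t, x + X s ω ≤ 0 := by
  constructor
  · intro h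
    obtain ⟨s, hs⟩ := WithTop.ne_top_iff_exists.1 (h.trans_lt (WithTop.coe_lt_top t)).ne
    refine ⟨s, ?_, le_zero_of_defaultTime_eq hω hs.symm⟩
    rw [← hs] at h
    exact WithTop.coe_le_coe.1 h
  · rintro ⟨s, hst, hs⟩
    exact (defaultTime_le_of_le_zero hs).trans (WithTop.coe_le_coe.2 hst)

/-- By `hq`, approaching `(-∞, 0]` by a given time means having entered it, so the supremum in
`defaultDiscount` runs over the dense times at or after default, measured from `t`, and the largest
discounts are those nearest to default. The hypotheses on `ω` do not involve `t`, so `t` may later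
be random. -/
lemma discount_defaultTime_eq {r : ℝ} (hr : 0 < r)
    (hω : ∀ t : ℝ≥0, ContinuousWithinAt (fun s => X s ω) (Set.Ici t) t)
    (hq : ∀ T : ℝ≥0, (∀ n : ℕ, ∃ s ≤ T, x + X s ω < 1 / (n + 1)) → ∃ s ≤ T, x + X s ω ≤ 0)
    {t : ℝ≥0} (ht : t ≤ defaultTime X x ω) :
    discount r (defaultTime X x ω) =
      discount r t * defaultDiscount r (x + X t ω, increments X t ω) := by
  set p : ℝ × (ℝ≥0 → ℝ) := (x + X t ω, increments X t ω) with hp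
  have hadd : ∀ u : ℝ≥0, p.1 + p.2 u = x + X (t + u) ω := fun u => by
    simp only [hp, increments]
    ring
  have hexp : ∀ u : ℝ≥0, discount r (t : WithTop ℝ≥0) * discount r (u : WithTop ℝ≥0) =
      discount r ((t + u : ℝ≥0) : WithTop ℝ≥0) := fun u => by
    simp only [discount_coe, ← Real.exp_add, NNReal.coe_add]
    congr 1
    ring
  apply le_antisymm
  · rcases eq_or_ne (defaultTime X x ω) ⊤ with h | h
    · rw [h, discount_top]
      exact mul_nonneg (discount_nonneg _) (defaultDiscount_mem hr p).1
    obtain ⟨s, hs⟩ := WithTop.ne_top_iff_exists.1 h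
    obtain ⟨d, rfl⟩ := exists_add_of_le (show t ≤ s by rwa [← hs, WithTop.coe_le_coe] at ht)
    have hle := le_zero_of_defaultTime_eq hω hs.symm
    rw [← hs, ← hexp]
    refine mul_le_mul_of_nonneg_left ?_ (discount_nonneg _)
    -- Otherwise some dense time strictly after `d` would still have a discount above the supremum,
    -- although the path has entered by then.
    by_contra! hlt
    have hcont : ContinuousWithinAt (fun u : ℝ≥0 => discount r (u : WithTop ℝ≥0)) (Set.Ici d) d := by
      simp only [discount_coe]
      fun_prop
    obtain ⟨j, hdj, -, hj⟩ := exists_denseTime_mem_of_rightCont hcont isOpen_Ioi hlt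
      (lt_add_of_pos_right d one_pos)
    refine (discount_le_defaultDiscount hr (p := p) fun n => ?_).not_gt hj
    have hcont' : ContinuousWithinAt (fun u => x + X (t + u) ω) (Set.Ici d) d := by
      refine continuousWithinAt_const.add ?_
      refine (hω (t + d)).comp (t := Set.Ici (t + d)) (f := fun s => t + s)
        (by fun_prop) fun s hs => ?_
      exact add_le_add_right (Set.mem_Ici.1 hs) _
    obtain ⟨i, -, hi, hin⟩ := exists_denseTime_mem_of_rightCont hcont'
      (isOpen_Iio (a := 1 / ((n : ℝ) + 1))) (hle.trans_lt (by positivity)) hdj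
    exact ⟨i, hi.le, by rw [hadd]; exact hin⟩
  · rw [defaultDiscount, Real.mul_iSup_of_nonneg (discount_nonneg _)]
    refine ciSup_le fun j => ?_
    split_ifs with hj
    · rw [hexp]
      refine discount_antitone hr ((defaultTime_le_iff hω).2 (hq _ fun n => ?_))
      obtain ⟨i, hi, hin⟩ := hj n
      rw [hadd] at hin
      exact ⟨_, add_le_add_right hi t, hin⟩
    · simpa using discount_nonneg _

end

/-! ### Default as a stopping time; the CDS price -/

section

variable {Ω : Type*} [mΩ : MeasurableSpace Ω] {P : Measure Ω} {X : ℝ≥0 → Ω → ℝ}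
  [IsProbabilityMeasure P] [P.IsComplete]

/-- The default time is a stopping time of the completed filtration. -/
lemma IsLevyProcess.isStoppingTime_defaultTime (hX : IsLevyProcess X P) (x : ℝ) :
    IsStoppingTime (completedFiltration P X hX.measurable) (defaultTime X x) := by
  intro t
  -- By quasi-left-continuity, `θ ≤ t` means almost surely that every level `1 / (n + 1)` is
  -- undershot by time `t`. The endpoint `t` is listed separately, so no information after `t` is
  -- needed.
  have h : MeasurableSet[completedFiltration P X hX.measurable t]
      (⋂ n : ℕ, ({ω | ∃ s < t, x + X s ω < 1 / ((n : ℝ) + 1)} ∪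
        {ω | x + X t ω < 1 / ((n : ℝ) + 1)})) :=
    MeasurableSet.iInter fun n => (hX.measurableSet_exists_lt x _ t).union
      (((measurable_completedFiltration hX.measurable le_rfl).const_add x) measurableSet_Iio)
  refine measurableSet_completedFiltration_congr h ?_
  filter_upwards [hX.rightCont, hX.ae_exists_le_zero x] with ω hω hq
  simp only [Set.mem_ofPred_eq, Set.mem_iInter, Set.mem_union]
  rw [defaultTime_le_iff hω]
  constructor
  · rintro ⟨s, hs, hle⟩ n
    have hlt : x + X s ω < 1 / ((n : ℝ) + 1) := hle.trans_lt (by positivity)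
    rcases hs.lt_or_eq with h | rfl
    · exact Or.inl ⟨s, h, hlt⟩
    · exact Or.inr hlt
  · intro h
    refine hq t fun n => ?_
    rcases h n with ⟨s, hs, hlt⟩ | hlt
    · exact ⟨s, hs.le, hlt⟩
    · exact ⟨t, le_rfl, hlt⟩

/-- The expected discount factor at default of the process started at `y`. -/
noncomputable def expectedDiscount (P : Measure Ω) (X : ℝ≥0 → Ω → ℝ) (r y : ℝ) : ℝ :=
  ∫ w, defaultDiscount r (y, w) ∂(P.map fun ω t => X t ω)

omit [P.IsComplete] [IsProbabilityMeasure P] in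
lemma measurable_expectedDiscount [IsFiniteMeasure P] (r : ℝ) :
    Measurable (expectedDiscount P X r) :=
  (StronglyMeasurable.integral_prod_right (f := fun y w => defaultDiscount r (y, w))
    (measurable_defaultDiscount r).stronglyMeasurable).measurable

omit [P.IsComplete] in
lemma IsLevyProcess.expectedDiscount_mem (hX : IsLevyProcess X P) {r : ℝ} (hr : 0 < r) (y : ℝ) :
    expectedDiscount P X r y ∈ Set.Icc (0 : ℝ) 1 := by
  have := Measure.isProbabilityMeasure_map (μ := P) hX.measurable_path.aemeasurable
  refine ⟨integral_nonneg fun w => (defaultDiscount_mem hr _).1, ?_⟩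
  refine (integral_mono_of_nonneg (Eventually.of_forall fun w => (defaultDiscount_mem hr _).1)
    (integrable_const (1 : ℝ))
    (Eventually.of_forall fun w => (defaultDiscount_mem hr (y, w)).2)).trans ?_
  simp

lemma IsLevyProcess.integral_discount_defaultTime (hX : IsLevyProcess X P) {r : ℝ} (hr : 0 < r)
    (y : ℝ) : ∫ ω, discount r (defaultTime X y ω) ∂P = expectedDiscount P X r y := by
  rw [expectedDiscount, integral_map hX.measurable_path.aemeasurable]
  · refine integral_congr_ae ?_
    filter_upwards [hX.rightCont, hX.ae_exists_le_zero y, hX.zero] with ω hω hq h0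
    rw [discount_defaultTime_eq hr hω hq (t := 0) bot_le, WithTop.coe_zero, discount_zero,
      one_mul, h0, add_zero]
    congr 2
    ext t
    simp [increments, h0]
  · exact ((measurable_defaultDiscount r).comp measurable_prodMk_left).aestronglyMeasurable

omit mΩ in
lemma cdsCashFlow_eq {r : ℝ} (hr : 0 < r) (x p α : ℝ) (ω : Ω) :
    cdsCashFlow X r x p α ω = -(p / r) + (p / r + α) * discount r (defaultTime X x ω) := by
  rw [cdsCashFlow, premiumLeg_eq hr p (zero_le), discount_zero]
  ring

lemma IsLevyProcess.integrable_discount (hX : IsLevyProcess X P) {r : ℝ} (hr : 0 < r)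
    {τ : Ω → WithTop ℝ≥0} (hτ : IsStoppingTime (completedFiltration P X hX.measurable) τ) :
    Integrable (fun ω => discount r (τ ω)) P :=
  .of_mem_Icc 0 1 (measurable_discount.comp hτ.measurable').aemeasurable
    (Eventually.of_forall fun _ => ⟨discount_nonneg _, discount_le_one hr _⟩)

lemma IsLevyProcess.integrable_cdsCashFlow (hX : IsLevyProcess X P) {r : ℝ} (hr : 0 < r)
    (x p α : ℝ) : Integrable (cdsCashFlow X r x p α) P := by
  rw [funext (cdsCashFlow_eq hr x p α)]
  exact (integrable_const _).add
    ((hX.integrable_discount hr (hX.isStoppingTime_defaultTime x)).const_mul _)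

/-- Being affine in `expectedDiscount`, the price is bounded and measurable in the starting point.
-/
lemma IsLevyProcess.C_eq (hX : IsLevyProcess X P) {r : ℝ} (hr : 0 < r) (y p α : ℝ) :
    C P X r y p α = -(p / r) + (p / r + α) * expectedDiscount P X r y := by
  rw [C, funext (cdsCashFlow_eq hr y p α), integral_add (integrable_const _)
    ((hX.integrable_discount hr (hX.isStoppingTime_defaultTime y)).const_mul _),
    integral_const_mul, hX.integral_discount_defaultTime hr]
  simp

end

/-! ### Restarting at a stopping time before default -/

section Stopped

variable {Ω : Type*} [mΩ : MeasurableSpace Ω] {P : Measure Ω} {X : ℝ≥0 → Ω → ℝ}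

lemma min_gridAbove_tendsto {f : ℝ≥0 → ℝ} (hf : ∀ t, ContinuousWithinAt f (Set.Ici t) t)
    {ρ t : ℝ≥0} (hρ : ρ ≤ t) : Tendsto (fun k => f (min (gridAbove k ρ) t)) atTop (𝓝 (f ρ)) := by
  refine (hf ρ).tendsto.comp (tendsto_nhdsWithin_iff.2 ⟨?_, ?_⟩)
  · have h := ((tendsto_nhdsWithin_iff.1 (tendsto_gridAbove ρ)).1).min
      (tendsto_const_nhds (x := t))
    rwa [min_eq_left hρ] at h
  · exact Eventually.of_forall fun k => le_min (lt_gridAbove k ρ).le hρ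

lemma coe_untopA {a : WithTop ℝ≥0} (ha : a ≠ ⊤) : (a.untopA : WithTop ℝ≥0) = a := by
  lift a to ℝ≥0 using ha
  rfl

variable [P.IsComplete]

/-- The pair `(τ, X τ)` is measurable with respect to the past of the stopping time `τ`. -/
lemma IsLevyProcess.measurableSet_stopped (hX : IsLevyProcess X P) {τ : Ω → WithTop ℝ≥0}
    (hτ : IsStoppingTime (completedFiltration P X hX.measurable) τ) {S : Set (ℝ≥0 × ℝ)}
    (hS : MeasurableSet S) (t : ℝ≥0) :
    MeasurableSet[completedFiltration P X hX.measurable t]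
      ({ω | ((τ ω).untopA, X (τ ω).untopA ω) ∈ S} ∩ {ω | τ ω ≤ t}) := by
  set F := completedFiltration P X hX.measurable
  set ρ : Ω → ℝ≥0 := fun ω => (min (τ ω) t).untopA
  have hρ : Measurable[F t] ρ :=
    ((hτ.min_const t).measurable_of_le fun _ => min_le_right _ _).untopA
  -- Capping the grid times at `t` keeps the approximations `F t`-measurable; their `limsup` is
  -- measurable everywhere and almost surely equals the stopped value on `τ ≤ t`.
  set Z : ℕ → Ω → ℝ := fun k ω => X (min (gridAbove k (ρ ω)) t) ω
  have hZ : ∀ k, Measurable[F t] (Z k) := fun k => by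
    have hc : Measurable[F t] fun ω => ⌊((k : ℝ≥0) + 1) * ρ ω⌋₊ :=
      Nat.measurable_floor.comp (hρ.const_mul _)
    exact @measurable_apply_nat Ω (F t)
      (fun j => X (min (((j : ℝ≥0) + 1) / (k + 1)) t))
      (fun j => measurable_completedFiltration hX.measurable (min_le_right _ _)) _ hc
  have hlim : Measurable[F t] fun ω => limsup (fun k => Z k ω) atTop := Measurable.limsup hZ
  have hmeas : MeasurableSet[F t]
      ({ω | (ρ ω, limsup (fun k => Z k ω) atTop) ∈ S} ∩ {ω | τ ω ≤ t}) :=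
    ((hρ.prodMk hlim) hS).inter (hτ t)
  refine measurableSet_completedFiltration_congr hmeas ?_
  filter_upwards [hX.rightCont] with ω hω
  simp only [Set.mem_inter_iff, Set.mem_ofPred_eq]
  refine and_congr_left fun hle => ?_
  have hρω : ρ ω = (τ ω).untopA := by simp only [ρ, min_eq_left hle]
  have hρt : ρ ω ≤ t := by
    rw [hρω, ← WithTop.coe_le_coe, coe_untopA (hle.trans_lt (WithTop.coe_lt_top t)).ne]
    exact hle
  rw [(min_gridAbove_tendsto (f := fun s => X s ω) hω hρt).limsup_eq, hρω]

/-- On `{τ < θ}`, events of the past of `τ` are events of the past of the optional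
time `τ.untopA`. -/
lemma IsLevyProcess.measurableSet_optional (hX : IsLevyProcess X P) {τ : Ω → WithTop ℝ≥0}
    {A : Set Ω} (hA : ∀ t : ℝ≥0,
      MeasurableSet[completedFiltration P X hX.measurable t] (A ∩ {ω | τ ω ≤ t}))
    (htop : ∀ ω ∈ A, τ ω ≠ ⊤) (t : ℝ≥0) :
    MeasurableSet[completedFiltration P X hX.measurable t] (A ∩ {ω | (τ ω).untopA < t}) := by
  have : A ∩ {ω | (τ ω).untopA < t} =
      ⋃ j : {j // denseTime j < t}, A ∩ {ω | τ ω ≤ denseTime j} := by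
    ext ω
    simp only [Set.mem_inter_iff, Set.mem_ofPred_eq, Set.mem_iUnion, Subtype.exists, exists_prop]
    constructor
    · rintro ⟨h, hlt⟩
      obtain ⟨j, h1, h2⟩ := exists_denseTime_btwn hlt
      refine ⟨j, h2, h, ?_⟩
      rw [← coe_untopA (htop ω h)]
      exact WithTop.coe_le_coe.2 h1.le
    · rintro ⟨j, h2, h, hle⟩
      refine ⟨h, lt_of_le_of_lt ?_ h2⟩
      rw [← coe_untopA (htop ω h)] at hle
      exact WithTop.coe_le_coe.1 hle
  rw [this]
  exact MeasurableSet.iUnion fun j =>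
    (completedFiltration P X hX.measurable).mono j.2.le _ (hA _)

lemma IsLevyProcess.measurable_stopped (hX : IsLevyProcess X P) {τ : Ω → WithTop ℝ≥0}
    (hτ : IsStoppingTime (completedFiltration P X hX.measurable) τ) :
    Measurable fun ω => X (τ ω).untopA ω := by
  simpa using hX.measurable_eval hτ.measurable'.untopA 0

variable [IsProbabilityMeasure P]

lemma IsLevyProcess.measurableSet_lt_default (hX : IsLevyProcess X P) {τ : Ω → WithTop ℝ≥0}
    (hτ : IsStoppingTime (completedFiltration P X hX.measurable) τ) (x : ℝ) (t : ℝ≥0) :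
    MeasurableSet[completedFiltration P X hX.measurable t]
      ({ω | τ ω < defaultTime X x ω} ∩ {ω | τ ω ≤ t}) := by
  have h := (IsStoppingTime.measurableSet_stopping_time_le
    (hX.isStoppingTime_defaultTime x) hτ).compl.2 t
  convert h using 2
  ext ω
  simp

/-- The strong Markov property at a stopping time `τ` before default: past and future increments
are independent. -/
lemma IsLevyProcess.map_stopped_increments (hX : IsLevyProcess X P) {τ : Ω → WithTop ℝ≥0}
    (hτ : IsStoppingTime (completedFiltration P X hX.measurable) τ) (x : ℝ) :
    (P.restrict {ω | τ ω < defaultTime X x ω}).map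
        (fun ω => (((τ ω).untopA, X (τ ω).untopA ω), increments X (τ ω).untopA ω)) =
      ((P.restrict {ω | τ ω < defaultTime X x ω}).map
        (fun ω => ((τ ω).untopA, X (τ ω).untopA ω))).prod (P.map fun ω t => X t ω) := by
  set A := {ω | τ ω < defaultTime X x ω}
  have hρ : Measurable fun ω => (τ ω).untopA := hτ.measurable'.untopA
  have hZ : Measurable fun ω => ((τ ω).untopA, X (τ ω).untopA ω) :=
    hρ.prodMk (hX.measurable_stopped hτ)
  have hY := hX.measurable_postIncrements hρ
  symm
  refine Measure.prod_eq fun S B hS hB => ?_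
  rw [Measure.map_apply (hZ.prodMk hY) (hS.prod hB), Measure.map_apply hZ hS,
    Measure.restrict_apply (hZ hS), Measure.restrict_apply ((hZ.prodMk hY) (hS.prod hB))]
  -- On a rectangle `S × B`, the condition `S` and `τ < θ` form an event of the past of `τ`, on
  -- which `τ` is finite and `strongMarkov` gives the factor for `B`.
  have hA : ∀ t : ℝ≥0, MeasurableSet[completedFiltration P X hX.measurable t]
      (((fun ω => ((τ ω).untopA, X (τ ω).untopA ω)) ⁻¹' S ∩ A) ∩ {ω | τ ω ≤ t}) := fun t => by
    have h := (hX.measurableSet_stopped hτ hS t).inter (hX.measurableSet_lt_default hτ x t)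
    convert h using 1
    ext ω
    simp only [A, Set.mem_inter_iff, Set.mem_preimage, Set.mem_ofPred_eq]
    tauto
  have h := congrArg (fun μ => μ B) (hX.strongMarkov hρ (hX.measurableSet_optional hA
    fun ω hω => (lt_top_of_lt (show τ ω < defaultTime X x ω from hω.2)).ne))
  simp only [Measure.smul_apply, smul_eq_mul] at h
  rw [Measure.map_apply hY hB, Measure.restrict_apply (hY hB)] at h
  rw [← h]
  congr 1
  ext ω
  simp only [Set.mem_inter_iff, Set.mem_preimage, Set.mem_prod]
  tauto

/-- The expected discount factor at default after a stopping time `τ`, computed by restarting the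
process at `τ`. -/
lemma IsLevyProcess.setIntegral_discount_defaultTime (hX : IsLevyProcess X P) {r : ℝ} (hr : 0 < r)
    {τ : Ω → WithTop ℝ≥0} (hτ : IsStoppingTime (completedFiltration P X hX.measurable) τ) (x : ℝ) :
    ∫ ω in {ω | τ ω < defaultTime X x ω}, discount r (defaultTime X x ω) ∂P =
      ∫ ω in {ω | τ ω < defaultTime X x ω},
        discount r (τ ω) * expectedDiscount P X r (x + X (τ ω).untopA ω) ∂P := by
  set A := {ω | τ ω < defaultTime X x ω}
  have hAm : MeasurableSet A :=
    measurableSet_lt hτ.measurable' (hX.isStoppingTime_defaultTime x).measurable'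
  have hρ : Measurable fun ω => (τ ω).untopA := hτ.measurable'.untopA
  have hZ : Measurable fun ω => ((τ ω).untopA, X (τ ω).untopA ω) :=
    hρ.prodMk (hX.measurable_stopped hτ)
  have hY := hX.measurable_postIncrements hρ
  have hcoe : ∀ ω ∈ A, ((τ ω).untopA : WithTop ℝ≥0) = τ ω := fun ω hω =>
    coe_untopA (lt_top_of_lt (show τ ω < defaultTime X x ω from hω)).ne
  let Φ : (ℝ≥0 × ℝ) × (ℝ≥0 → ℝ) → ℝ := fun q =>
    discount r (q.1.1 : WithTop ℝ≥0) * defaultDiscount r (x + q.1.2, q.2)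
  have hΦ : Measurable Φ := by
    refine (measurable_discount.comp measurable_fst.fst.withTop_coe).mul
      ((measurable_defaultDiscount r).comp ?_)
    exact (measurable_fst.snd.const_add x).prodMk measurable_snd
  have hprob := Measure.isProbabilityMeasure_map (μ := P) hX.measurable_path.aemeasurable
  have h1 : ∫ ω in A, discount r (defaultTime X x ω) ∂P =
      ∫ ω in A, Φ (((τ ω).untopA, X (τ ω).untopA ω), increments X (τ ω).untopA ω) ∂P := by
    refine setIntegral_congr_ae hAm ?_
    filter_upwards [hX.rightCont, hX.ae_exists_le_zero x] with ω hω hq hA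
    exact discount_defaultTime_eq hr hω hq
      ((hcoe ω hA).trans_le (show τ ω < defaultTime X x ω from hA).le)
  have hΦi : ∀ (μ : Measure ((ℝ≥0 × ℝ) × (ℝ≥0 → ℝ))) [IsFiniteMeasure μ], Integrable Φ μ :=
    fun μ _ => .of_mem_Icc 0 1 hΦ.aemeasurable (Eventually.of_forall fun q =>
      ⟨mul_nonneg (discount_nonneg _) (defaultDiscount_mem hr _).1,
        mul_le_one₀ (discount_le_one hr _) (defaultDiscount_mem hr _).1
          (defaultDiscount_mem hr _).2⟩)
  have h2 := integral_map (μ := P.restrict A) (hZ.prodMk hY).aemeasurable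
    (f := Φ) hΦ.aestronglyMeasurable
  -- Fubini: integrating out the future with `(τ, X τ)` frozen produces `expectedDiscount`.
  rw [h1, ← h2, hX.map_stopped_increments hτ x, integral_prod _ (hΦi _), integral_map
    hZ.aemeasurable]
  · refine setIntegral_congr_fun hAm fun ω hω => ?_
    simp only [Φ, integral_const_mul, expectedDiscount]
    rw [hcoe ω hω]
  · exact (StronglyMeasurable.integral_prod_right (f := fun z w => Φ (z, w))
      hΦ.stronglyMeasurable).aestronglyMeasurable

end Stopped

/-! ### Cash-flow decomposition and the modified exercise rule -/

section Swap

variable {Ω : Type*} [mΩ : MeasurableSpace Ω] {P : Measure Ω} [IsProbabilityMeasure P]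
  [P.IsComplete] {X : ℝ≥0 → Ω → ℝ}

/-- The discounted value `e^{-rτ} g(X τ)` collected at `τ` if `τ` comes before default. -/
noncomputable def earlyPayoff (X : ℝ≥0 → Ω → ℝ) (r x : ℝ) (g : ℝ → ℝ) (τ : Ω → WithTop ℝ≥0) :
    Ω → ℝ :=
  {ω | τ ω < defaultTime X x ω}.indicator fun ω =>
    discount r (τ ω) * g (x + X (τ ω).untopA ω)

lemma IsLevyProcess.measurableSet_lt_defaultTime (hX : IsLevyProcess X P) {τ : Ω → WithTop ℝ≥0}
    (hτ : IsStoppingTime (completedFiltration P X hX.measurable) τ) (x : ℝ) :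
    MeasurableSet {ω | τ ω < defaultTime X x ω} :=
  measurableSet_lt hτ.measurable' (hX.isStoppingTime_defaultTime x).measurable'

omit [IsProbabilityMeasure P] [P.IsComplete] mΩ in
lemma norm_earlyPayoff_le {r : ℝ} (hr : 0 < r) {x M : ℝ} {g : ℝ → ℝ} (hM : ∀ y, |g y| ≤ M)
    (τ : Ω → WithTop ℝ≥0) (ω : Ω) : ‖earlyPayoff X r x g τ ω‖ ≤ M := by
  refine (norm_indicator_le_norm_self _ ω).trans ?_
  rw [norm_mul, Real.norm_eq_abs, abs_of_nonneg (discount_nonneg _)]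
  exact (mul_le_of_le_one_left (norm_nonneg _) (discount_le_one hr _)).trans (hM _)

lemma IsLevyProcess.integrable_earlyPayoff (hX : IsLevyProcess X P) {r : ℝ} (hr : 0 < r)
    {x M : ℝ} {g : ℝ → ℝ} (hg : Measurable g) (hM : ∀ y, |g y| ≤ M) {τ : Ω → WithTop ℝ≥0}
    (hτ : IsStoppingTime (completedFiltration P X hX.measurable) τ) :
    Integrable (earlyPayoff X r x g τ) P := by
  refine .of_bound (C := M) (Measurable.aestronglyMeasurable (Measurable.indicator ?_
    (hX.measurableSet_lt_defaultTime hτ x)))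
    (Eventually.of_forall fun ω => norm_earlyPayoff_le hr hM τ ω)
  exact (measurable_discount.comp hτ.measurable').mul
    (hg.comp ((hX.measurable_stopped hτ).const_add x))

/-- The exercise gain `-C(y; -(p - ph), -(α - αh)) - γ` of the default swaption. -/
noncomputable def exerciseGain (P : Measure Ω) (X : ℝ≥0 → Ω → ℝ) (r p ph α αh γ y : ℝ) : ℝ :=
  -C P X r y (-(p - ph)) (-(α - αh)) - γ

lemma IsLevyProcess.exerciseGain_eq (hX : IsLevyProcess X P) {r : ℝ} (hr : 0 < r)
    (p ph α αh γ y : ℝ) : exerciseGain P X r p ph α αh γ y =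
      -((p - ph) / r) - γ + ((p - ph) / r + (α - αh)) * expectedDiscount P X r y := by
  rw [exerciseGain, hX.C_eq hr]
  ring

lemma IsLevyProcess.measurable_exerciseGain (hX : IsLevyProcess X P) {r : ℝ} (hr : 0 < r)
    (p ph α αh γ : ℝ) : Measurable (exerciseGain P X r p ph α αh γ) := by
  rw [funext (hX.exerciseGain_eq hr p ph α αh γ)]
  exact ((measurable_expectedDiscount r).const_mul _).const_add _

lemma IsLevyProcess.exists_exerciseGain_bound (hX : IsLevyProcess X P) {r : ℝ} (hr : 0 < r)
    (p ph α αh γ : ℝ) : ∃ M, ∀ y, |exerciseGain P X r p ph α αh γ y| ≤ M := by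
  refine ⟨|-((p - ph) / r) - γ| + |(p - ph) / r + (α - αh)|, fun y => ?_⟩
  rw [hX.exerciseGain_eq hr]
  refine (abs_add_le _ _).trans (add_le_add_right ?_ _)
  have h := hX.expectedDiscount_mem hr y
  rw [abs_mul, abs_of_nonneg h.1]
  exact mul_le_of_le_one_right (abs_nonneg _) h.2

omit [IsProbabilityMeasure P] [P.IsComplete] in
lemma swaptionPayoff_eq (r x p ph α αh γ : ℝ) (τ : Ω → WithTop ℝ≥0) :
    swaptionPayoff P X r x (-(p - ph)) (-(α - αh)) γ τ =
      earlyPayoff X r x (fun y => max (exerciseGain P X r p ph α αh γ y) 0) τ := by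
  ext ω
  simp only [swaptionPayoff, earlyPayoff, Set.indicator, Set.mem_ofPred_eq]
  rfl

omit [P.IsComplete] mΩ [IsProbabilityMeasure P] in
/-- Away from the null set `{θ < τ}`, the seller's cash flow is that of a short credit default swap
plus the gain from switching before default. -/
lemma putableCashFlow_eq {r : ℝ} (hr : 0 < r) (x p ph α αh γ : ℝ) {τ : Ω → WithTop ℝ≥0} {ω : Ω}
    (h : τ ω ≤ defaultTime X x ω) :
    putableCashFlow X r x p ph α αh γ τ ω = -cdsCashFlow X r x p α ω +
      {ω | τ ω < defaultTime X x ω}.indicator (fun ω => (-((p - ph) / r) - γ) * discount r (τ ω)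
        + ((p - ph) / r + (α - αh)) * discount r (defaultTime X x ω)) ω := by
  rw [putableCashFlow, cdsCashFlow_eq hr, premiumLeg_eq hr p zero_le, premiumLeg_eq hr ph h,
    discount_zero]
  rcases h.lt_or_eq with hlt | heq
  · rw [if_pos (lt_top_of_lt hlt), if_pos hlt, if_neg hlt.ne,
      Set.indicator_of_mem (show ω ∈ {ω | τ ω < defaultTime X x ω} from hlt)]
    ring
  · have hnot : ω ∉ {ω | τ ω < defaultTime X x ω} := fun hlt =>
      (show τ ω < defaultTime X x ω from hlt).ne heq
    rw [Set.indicator_of_notMem hnot, heq, if_neg (lt_irrefl _), if_pos rfl]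
    -- At a finite `τ = θ` the payment is the vanilla `α`; at `τ = θ = ∞` none is made, in agreement
    -- with `e^{-r∞} = 0`.
    split_ifs with htop
    · ring
    · rw [not_lt_top_iff.1 htop, discount_top]
      ring

/-- Once `setIntegral_discount_defaultTime` has replaced the discount at default, the coefficients
are exactly those of `exerciseGain_eq`. -/
lemma IsLevyProcess.integrable_putableCashFlow (hX : IsLevyProcess X P) {r : ℝ} (hr : 0 < r)
    {x : ℝ} (p ph α αh γ : ℝ) {τ : Ω → WithTop ℝ≥0} (hτ : τ ∈ admissible P X hX.measurable x) :
    Integrable (putableCashFlow X r x p ph α αh γ τ) P ∧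
      ∫ ω, putableCashFlow X r x p ph α αh γ τ ω ∂P =
        -C P X r x p α + ∫ ω, earlyPayoff X r x (exerciseGain P X r p ph α αh γ) τ ω ∂P := by
  obtain ⟨hst, hle⟩ := hτ
  have hA := hX.measurableSet_lt_defaultTime hst x
  have hD := hX.integrable_discount hr hst
  have hDθ := hX.integrable_discount hr (hX.isStoppingTime_defaultTime x)
  have hae := hle.mono fun ω => putableCashFlow_eq (X := X) hr x p ph α αh γ (τ := τ) (ω := ω)
  have hcds : Integrable (fun ω => -cdsCashFlow X r x p α ω) P :=
    (hX.integrable_cdsCashFlow hr x p α).neg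
  have hgain : Integrable ({ω | τ ω < defaultTime X x ω}.indicator fun ω =>
      (-((p - ph) / r) - γ) * discount r (τ ω)
        + ((p - ph) / r + (α - αh)) * discount r (defaultTime X x ω)) P := ((hD.const_mul (-((p - ph) / r) - γ)).add
    (hDθ.const_mul ((p - ph) / r + (α - αh)))).indicator hA
  refine ⟨(hcds.add hgain).congr (hae.mono fun ω h => h.symm), ?_⟩
  rw [integral_congr_ae hae, integral_add hcds hgain, integral_neg, C]
  have hE : Integrable (fun ω => discount r (τ ω) * expectedDiscount P X r (x + X (τ ω).untopA ω))
      P := by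
    refine .of_mem_Icc 0 1 ((measurable_discount.comp hst.measurable').mul
      ((measurable_expectedDiscount r).comp
        ((hX.measurable_stopped hst).const_add x))).aemeasurable (Eventually.of_forall fun ω => ?_)
    have h := hX.expectedDiscount_mem hr (x + X (τ ω).untopA ω)
    exact ⟨mul_nonneg (discount_nonneg _) h.1, mul_le_one₀ (discount_le_one hr _) h.1 h.2⟩
  congr 1
  simp only [earlyPayoff]
  rw [integral_indicator hA, integral_indicator hA,
    integral_add (hD.const_mul _).integrableOn (hDθ.const_mul _).integrableOn,
    integral_const_mul, integral_const_mul, hX.setIntegral_discount_defaultTime hr hst x,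
    ← integral_const_mul, ← integral_const_mul,
    ← integral_add (hD.const_mul _).integrableOn (hE.const_mul _).integrableOn]
  refine integral_congr_ae (Eventually.of_forall fun ω => ?_)
  simp only [hX.exerciseGain_eq hr]
  ring

open Classical in
/-- Exercising at `τ` only for a nonnegative gain, and waiting until default otherwise. -/
noncomputable def exerciseIfNonneg (X : ℝ≥0 → Ω → ℝ) (x : ℝ) (g : ℝ → ℝ)
    (τ : Ω → WithTop ℝ≥0) (ω : Ω) : WithTop ℝ≥0 :=
  if τ ω < defaultTime X x ω ∧ 0 ≤ g (x + X (τ ω).untopA ω) then τ ω else defaultTime X x ω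

/-- The decision to exercise depends on the past of `τ` only. If `θ ≤ t`, either branch gives a time
at most `t`, so the complementary decision never has to be intersected with `θ ≤ t`. -/
lemma IsLevyProcess.exerciseIfNonneg_mem (hX : IsLevyProcess X P) {x : ℝ} {g : ℝ → ℝ}
    (hg : Measurable g) {τ : Ω → WithTop ℝ≥0} (hτ : τ ∈ admissible P X hX.measurable x) :
    exerciseIfNonneg X x g τ ∈ admissible P X hX.measurable x := by
  refine ⟨fun t => ?_, ?_⟩
  · have hS : MeasurableSet {q : ℝ≥0 × ℝ | 0 ≤ g (x + q.2)} :=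
      measurableSet_le measurable_const (hg.comp (measurable_snd.const_add x))
    have h := ((hX.measurableSet_stopped hτ.1 hS t).inter
      (hX.measurableSet_lt_default hτ.1 x t)).union (hX.isStoppingTime_defaultTime x t)
    convert h using 1
    ext ω
    simp only [exerciseIfNonneg, Set.mem_ofPred_eq, Set.mem_union, Set.mem_inter_iff]
    split_ifs with hc
    · have := hc.1
      constructor
      · tauto
      · rintro (h | h)
        · exact h.1.2
        · exact this.le.trans h
    · tauto
  · filter_upwards [hτ.2] with ω hω
    rw [exerciseIfNonneg]
    split_ifs
    · exact hω
    · exact le_rfl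

-- Where `g < 0` the new time is `θ`, which the indicator of stopping before default sends to `0`.
omit [P.IsComplete] mΩ [IsProbabilityMeasure P] in
lemma earlyPayoff_exerciseIfNonneg (r x : ℝ) (g : ℝ → ℝ) (τ : Ω → WithTop ℝ≥0) :
    earlyPayoff X r x g (exerciseIfNonneg X x g τ) =
      earlyPayoff X r x (fun y => max (g y) 0) τ := by
  ext ω
  simp only [earlyPayoff, Set.indicator, Set.mem_ofPred_eq, exerciseIfNonneg]
  by_cases h1 : τ ω < defaultTime X x ω
  · by_cases h2 : 0 ≤ g (x + X (τ ω).untopA ω)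
    · simp [h1, h2]
    · simp [h1, h2, (not_le.1 h2).le]
  · simp [h1]

lemma IsLevyProcess.defaultTime_mem_admissible (hX : IsLevyProcess X P) (x : ℝ) :
    defaultTime X x ∈ admissible P X hX.measurable x :=
  ⟨hX.isStoppingTime_defaultTime x, Eventually.of_forall fun _ => le_rfl⟩

end Swap

end DefaultSwap

/-! ### Equality of the two suprema -/

open DefaultSwap in
theorem mainTheorem4 {Ω : Type*} [MeasurableSpace Ω] (P : Measure Ω) [IsProbabilityMeasure P]
    [P.IsComplete] (X : ℝ≥0 → Ω → ℝ) (hX : DefaultSwap.IsLevyProcess X P)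
    (r : ℝ) (hr : 0 < r) (x p ph α αh γ : ℝ) :
    Integrable (DefaultSwap.cdsCashFlow X r x p α) P ∧
    (∀ τ ∈ DefaultSwap.admissible P X hX.measurable x,
      Integrable (DefaultSwap.putableCashFlow X r x p ph α αh γ τ) P ∧
      Integrable (DefaultSwap.swaptionPayoff P X r x (-(p - ph)) (-(α - αh)) γ τ) P) ∧
    BddAbove (DefaultSwap.putableValues P X hX.measurable r x p ph α αh γ) ∧
    BddAbove (DefaultSwap.swaptionValues P X hX.measurable r x (-(p - ph)) (-(α - αh)) γ) ∧
    DefaultSwap.U P X hX.measurable r x p ph α αh γ =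
      -DefaultSwap.C P X r x p α
        + DefaultSwap.u P X hX.measurable r x (-(p - ph)) (-(α - αh)) γ := by
  have hg := hX.measurable_exerciseGain hr p ph α αh γ
  obtain ⟨M, hM⟩ := hX.exists_exerciseGain_bound hr p ph α αh γ
  set g := exerciseGain P X r p ph α αh γ
  have hg' : Measurable fun y => max (g y) 0 := hg.max measurable_const
  have hM' : ∀ y, |max (g y) 0| ≤ M := fun y => by
    rw [abs_of_nonneg (le_max_right _ _)]
    exact max_le ((le_abs_self _).trans (hM y)) ((abs_nonneg _).trans (hM y))
  have hput := fun τ (hτ : τ ∈ admissible P X hX.measurable x) =>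
    hX.integrable_putableCashFlow hr p ph α αh γ hτ
  have hgain := fun τ (hτ : τ ∈ admissible P X hX.measurable x) =>
    hX.integrable_earlyPayoff hr (x := x) hg hM hτ.1
  have hswap := fun τ (hτ : τ ∈ admissible P X hX.measurable x) =>
    hX.integrable_earlyPayoff hr (x := x) hg' hM' hτ.1
  have hbound : ∀ τ, ∫ ω, earlyPayoff X r x (fun y => max (g y) 0) τ ω ∂P ≤ M := fun τ => by
    have h := norm_integral_le_of_norm_le_const (μ := P)
      (Eventually.of_forall fun ω => norm_earlyPayoff_le (X := X) (x := x) hr hM' τ ω)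
    rw [probReal_univ, mul_one] at h
    exact (le_abs_self _).trans h
  have hle : ∀ τ ∈ admissible P X hX.measurable x,
      ∫ ω, earlyPayoff X r x g τ ω ∂P ≤ ∫ ω, earlyPayoff X r x (fun y => max (g y) 0) τ ω ∂P :=
    fun τ hτ => integral_mono (hgain τ hτ) (hswap τ hτ) fun ω =>
      Set.indicator_le_indicator (mul_le_mul_of_nonneg_left (le_max_left _ _) (discount_nonneg _))
  -- Waiting until default is admissible, so neither set of values is empty, as `csSup_le` requires.
  have hne := hX.defaultTime_mem_admissible x
  have hbddP : BddAbove (putableValues P X hX.measurable r x p ph α αh γ) := by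
    refine ⟨-C P X r x p α + M, ?_⟩
    rintro _ ⟨τ, hτ, rfl⟩
    simp only
    rw [(hput τ hτ).2]
    exact add_le_add_right ((hle τ hτ).trans (hbound τ)) _
  have hbddS : BddAbove (swaptionValues P X hX.measurable r x (-(p - ph)) (-(α - αh)) γ) := by
    refine ⟨M, ?_⟩
    rintro _ ⟨τ, hτ, rfl⟩
    simp only [swaptionPayoff_eq]
    exact hbound τ
  refine ⟨hX.integrable_cdsCashFlow hr x p α, fun τ hτ => ⟨(hput τ hτ).1, ?_⟩, hbddP, hbddS, ?_⟩
  · rw [swaptionPayoff_eq]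
    exact hswap τ hτ
  apply le_antisymm
  · refine csSup_le ⟨_, _, hne, rfl⟩ ?_
    rintro _ ⟨τ, hτ, rfl⟩
    simp only
    rw [(hput τ hτ).2]
    refine add_le_add_right ((hle τ hτ).trans (le_csSup hbddS ⟨τ, hτ, ?_⟩)) _
    simp only [swaptionPayoff_eq]
    rfl
  · rw [← le_sub_iff_add_le']
    refine csSup_le ⟨_, _, hne, rfl⟩ ?_
    rintro _ ⟨τ, hτ, rfl⟩
    -- The swaption value at `τ` is attained in the putable problem by the modified rule.
    have hτ' := hX.exerciseIfNonneg_mem hg hτ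
    rw [le_sub_iff_add_le']
    refine le_csSup hbddP ⟨_, hτ', ?_⟩
    simp only
    rw [(hput _ hτ').2, earlyPayoff_exerciseIfNonneg, swaptionPayoff_eq]
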